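/- Let $(U,U^-)$ be one of the two standard pairs of opposite minimal horospherical subgroups of $SL(3,\mathbb{C})$: either $$U=\left\{\begin{pmatrix}1&*&*\\0&1&0\\0&0&1\end{pmatrix}\right\},\qquad U^-=\left\{\begin{pmatrix}1&0&0\\ *&1&0\\ *&0&1\end{pmatrix}\right\},$$ and then let $H=\left\{\begin{pmatrix}1&0\\0&A\end{pmatrix}: A\in SL(2,\mathbb{C})\right\}$, or $$U=\left\{\begin{pmatrix}1&0&*\\0&1&*\\0&0&1\end{pmatrix}\right\},\qquad U^-=\left\{\begin{pmatrix}1&0&0\\0&1&0\\ *&*&1\end{pmatrix}\right\},$$ and then let $H=\left\{\begin{pmatrix}A&0\\0&1\end{pmatrix}: A\in SL(2,\mathbb{C})\right\}$. (In both cases $H$ is the commutator subgroup of the Levi subgroup $N(U)\cap N(U^-)$.) Identify $U$ and $U^-$ with $\mathbb{C}^2\cong\mathbb{R}^4$ through the entries marked $*$, so that the set of lattices in $U$ and the set of lattices in $U^-$ are each identified with $GL(4,\mathbb{R})/GL(4,\mathbb{Z})$, and give them the quotient topology. The group $H$ acts on lattices and on pairs of lattices by conjugation: $h.F=hFh^{-1}$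 and $h.(F_1,F_2)=(hF_1h^{-1},hF_2h^{-1})$. Let $F_1$ be a lattice in $U$ and $F_2$ a lattice in $U^-$ such that the subgroup $\langle F_1,F_2\rangle$ of $SL(3,\mathbb{C})$ generated by $F_1$ and $F_2$ is discrete, and let $E_1$ be a lattice in $U$ that lies in the closure $\overline{H.F_1}$ in the space of lattices in $U$. Then there is a lattice $E_2$ in $U^-$ such that $(E_1,E_2)$ lies in the closure $\overline{H.(F_1,F_2)}$ in the product of the two spaces of lattices, and $\langle E_1,E_2\rangle$ is discrete. -/

import Mathlib

open scoped MatrixGroups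

namespace Horospherical

/-- `ℂ²`, a real vector space of dimension four. -/
abbrev C2 := Fin 2 → ℂ

/-- The two standard pairs of opposite minimal horospherical subgroups of `SL(3, ℂ)`: in the
first one `U` sits in the first row and `U⁻` in the first column; in the second one `U` sits in
the last column and `U⁻` in the last row. -/
inductive PairType
  | first
  | second

/-- The general element of `U`. -/
def plusMat : PairType → C2 → Matrix (Fin 3) (Fin 3) ℂ
  | .first, x =>
    !![1, x 0, x 1;
       0, 1, 0;
       0, 0, 1]
  | .second, x =>
    !![1, 0, x 0;
       0, 1, x 1;
       0, 0, 1]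

/-- The general element of `U⁻`. -/
def minusMat : PairType → C2 → Matrix (Fin 3) (Fin 3) ℂ
  | .first, x =>
    !![1, 0, 0;
       x 0, 1, 0;
       x 1, 0, 1]
  | .second, x =>
    !![1, 0, 0;
       0, 1, 0;
       x 0, x 1, 1]

/-- The general element of `H`, for `A` of determinant one. -/
def leviMat : PairType → Matrix (Fin 2) (Fin 2) ℂ → Matrix (Fin 3) (Fin 3) ℂ
  | .first, A =>
    !![1, 0, 0;
       0, A 0 0, A 0 1;
       0, A 1 0, A 1 1]
  | .second, A =>
    !![A 0 0, A 0 1, 0;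
       A 1 0, A 1 1, 0;
       0, 0, 1]

theorem det_plusMat (τ : PairType) (x : C2) : (plusMat τ x).det = 1 := by
  cases τ <;> simp [plusMat, Matrix.det_fin_three]

theorem det_minusMat (τ : PairType) (x : C2) : (minusMat τ x).det = 1 := by
  cases τ <;> simp [minusMat, Matrix.det_fin_three]

theorem det_leviMat (τ : PairType) (A : Matrix (Fin 2) (Fin 2) ℂ) (hA : A.det = 1) :
    (leviMat τ A).det = 1 := by
  rw [Matrix.det_fin_two] at hA
  cases τ <;> simpa [leviMat, Matrix.det_fin_three] using hA

theorem plusMat_add (τ : PairType) (x y : C2) :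
    plusMat τ (x + y) = plusMat τ x * plusMat τ y := by
  cases τ <;> ext i j <;> fin_cases i <;> fin_cases j <;>
    simp [plusMat, Matrix.mul_apply, Fin.sum_univ_three, add_comm]

theorem minusMat_add (τ : PairType) (x y : C2) :
    minusMat τ (x + y) = minusMat τ x * minusMat τ y := by
  cases τ <;> ext i j <;> fin_cases i <;> fin_cases j <;>
    simp [minusMat, Matrix.mul_apply, Fin.sum_univ_three, add_comm]

theorem leviMat_mul (τ : PairType) (A B : Matrix (Fin 2) (Fin 2) ℂ) :
    leviMat τ (A * B) = leviMat τ A * leviMat τ B := by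
  cases τ <;> ext i j <;> fin_cases i <;> fin_cases j <;>
    simp [leviMat, Matrix.mul_apply, Fin.sum_univ_three, Fin.sum_univ_two]

/-- The isomorphism `ℂ² → U`, with values in `SL(3, ℂ)`. -/
def uPlus (τ : PairType) : Multiplicative C2 →* SL(3, ℂ) :=
  MonoidHom.mk' (fun x => ⟨plusMat τ x.toAdd, det_plusMat τ _⟩)
    fun x y => Subtype.ext (plusMat_add τ x.toAdd y.toAdd)

/-- The isomorphism `ℂ² → U⁻`, with values in `SL(3, ℂ)`. -/
def uMinus (τ : PairType) : Multiplicative C2 →* SL(3, ℂ) :=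
  MonoidHom.mk' (fun x => ⟨minusMat τ x.toAdd, det_minusMat τ _⟩)
    fun x y => Subtype.ext (minusMat_add τ x.toAdd y.toAdd)

/-- The block embedding of `SL(2, ℂ)` in `SL(3, ℂ)` whose image is the commutator subgroup of
the Levi subgroup, which is the intersection of the normalizers of `U` and `U⁻`. -/
def leviEmb (τ : PairType) : SL(2, ℂ) →* SL(3, ℂ) :=
  MonoidHom.mk' (fun A => ⟨leviMat τ A.1, det_leviMat τ _ A.2⟩)
    fun A B => Subtype.ext (leviMat_mul τ A.1 B.1)

/-- The group `H = [L, L]`, a copy of `SL(2, ℂ)`. -/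
def H (τ : PairType) : Subgroup SL(3, ℂ) := (leviEmb τ).range

/-- `F` is a lattice in the image of `u : ℂ² → SL(3, ℂ)`: it corresponds under `u` to a discrete
additive subgroup of `ℂ²` that spans `ℂ²` over `ℝ`. -/
def IsLatticeIn (u : Multiplicative C2 →* SL(3, ℂ)) (F : Subgroup SL(3, ℂ)) : Prop :=
  ∃ (Λ : Submodule ℤ C2) (_ : DiscreteTopology Λ),
    IsZLattice ℝ Λ ∧ F = (AddSubgroup.toSubgroup Λ.toAddSubgroup).map u

/-- The set of lattices in the image of `u`. -/
def LatticeSpace (u : Multiplicative C2 →* SL(3, ℂ)) : Type :=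
  {F : Subgroup SL(3, ℂ) // IsLatticeIn u F}

/-- The real bases of `ℂ²`, as a subspace of `(ℂ²)⁴`: a copy of `GL(4, ℝ)`. -/
abbrev Frame : Type := {b : Fin 4 → C2 // LinearIndependent ℝ b}

/-- A basis of `ℂ²` over `ℝ` spans a lattice. -/
theorem isLatticeIn_frame (u : Multiplicative C2 →* SL(3, ℂ)) (b : Frame) :
    IsLatticeIn u
      ((AddSubgroup.toSubgroup (Submodule.span ℤ (Set.range b.1)).toAddSubgroup).map u) := by
  have hc : Fintype.card (Fin 4) = Module.finrank ℝ C2 := by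
    simp [C2, Module.finrank_pi_fintype, Complex.finrank_real_complex]
  have hb : Set.range b.1 = Set.range (basisOfLinearIndependentOfCardEqFinrank b.2 hc) := by
    rw [coe_basisOfLinearIndependentOfCardEqFinrank]
  rw [hb]
  exact ⟨_, inferInstance, inferInstance, rfl⟩

/-- The lattice with a given basis. -/
noncomputable def latticeOfFrame (u : Multiplicative C2 →* SL(3, ℂ)) (b : Frame) : LatticeSpace u :=
  ⟨_, isLatticeIn_frame u b⟩

/-- The topology of `GL(4, ℝ) / GL(4, ℤ)` on the space of lattices: the quotient topology for the
map that sends a basis to the lattice with that basis. -/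
noncomputable instance (u : Multiplicative C2 →* SL(3, ℂ)) : TopologicalSpace (LatticeSpace u) :=
  TopologicalSpace.coinduced (latticeOfFrame u) inferInstance

/-- The conjugate `h F h⁻¹`. -/
def conj (h : SL(3, ℂ)) (F : Subgroup SL(3, ℂ)) : Subgroup SL(3, ℂ) :=
  F.map (MulAut.conj h).toMonoidHom

/-- The orbit `H.F` of a lattice under conjugation by `H`. -/
def orbit {u : Multiplicative C2 →* SL(3, ℂ)} (H : Subgroup SL(3, ℂ)) (F : LatticeSpace u) :
    Set (LatticeSpace u) :=
  {E | ∃ h ∈ H, E.1 = conj h F.1}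

/-- The orbit `H.(F₁, F₂)` of a pair of lattices under simultaneous conjugation by `H`. -/
def orbitPair {u v : Multiplicative C2 →* SL(3, ℂ)} (H : Subgroup SL(3, ℂ))
    (F₁ : LatticeSpace u) (F₂ : LatticeSpace v) : Set (LatticeSpace u × LatticeSpace v) :=
  {E | ∃ h ∈ H, E.1.1 = conj h F₁.1 ∧ E.2.1 = conj h F₂.1}

end Horospherical

open scoped Matrix.Norms.Operator commutatorElement
open Filter Topology MeasureTheory Module

/-! Choose bases of lattices `hF₁h⁻¹` converging along an ultrafilter to a basis of `E₁`. It remains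
to make `hF₂h⁻¹` converge and to keep discreteness in the limit.

Compactness: `H` acts on `U⁻` with real determinant one, so the lattices `hF₂h⁻¹` have constant
covolume, and Mahler's criterion (`exists_tendsto_basis_of_minimum_le`) only asks for a lower bound
on their nonzero vectors (`exists_minimum_le`). If a vector of `U⁻` were too short, conjugation by a
central element of the Levi subgroup of `GL(3, ℂ)` would bring it and the bounded basis in `U` close
to 1 together. By Zassenhaus' theorem some nontrivial `z` near 1 in the discrete group commutes with
all of them. Their common centralizer is scalar, and a scalar of determinant one near 1 is trivial.

Discreteness (`discreteTopology_of_le_limits`): if the limit group is not discrete, the complex span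
of its elements near 1 is, at a small enough scale, stable under conjugation by the group, hence
under brackets with the Lie algebras of `U` and `U⁻`, hence is all of `M₃(ℂ)`. Nine linearly
independent elements near 1 are then approximated inside a discrete group `h⟨F₁, F₂⟩h⁻¹`, where
Zassenhaus' theorem makes them all trivial. -/

/-! ### Geometry of numbers and Mahler's criterion -/

/-- If the short vectors lie in the kernel of a unit functional `F`, stretch the ball of radius `r`
by a factor `T` transversally to that kernel. Minkowski's theorem finds a nonzero lattice point in
the stretched ball; being short, it is killed by `F`, so it was not stretched and has norm less than
`r`. -/
theorem exists_span_shortVectors_eq_top {E : Type*} [NormedAddCommGroup E] [NormedSpace ℝ E]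
    [FiniteDimensional ℝ E] [MeasurableSpace E] [BorelSpace E] (μ : Measure E)
    [μ.IsAddHaarMeasure] {V : ENNReal} (hV : V ≠ ⊤) {r : ℝ} (hr : 0 < r) :
    ∃ R : ℝ, ∀ {ι : Type} [Finite ι] (b : Basis ι ℝ E), μ (ZSpan.fundamentalDomain b) ≤ V →
      (∀ x ∈ Submodule.span ℤ (Set.range b), x ≠ 0 → r ≤ ‖x‖) →
      Submodule.span ℝ {x | x ∈ Submodule.span ℤ (Set.range b) ∧ ‖x‖ ≤ R} = ⊤ := by
  have hball : μ (Metric.ball (0 : E) r) ≠ 0 := (Metric.measure_ball_pos μ 0 hr).ne'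
  obtain ⟨T, hT⟩ : ∃ T : ℕ, V * 2 ^ finrank ℝ E < T * μ (Metric.ball (0 : E) r) :=
    ENNReal.exists_nat_mul_gt hball (ENNReal.mul_ne_top hV (by finiteness))
  -- This bounds the stretched ball: `y` moves by at most `|F y| (T - 1) ‖t‖`, where `‖t‖ ≤ 2`.
  refine ⟨r + T * r * 2, fun {ι} _ b hb hmin => ?_⟩
  by_contra hW
  obtain ⟨f, hf0, hf⟩ := Submodule.exists_le_ker_of_lt_top _ (lt_top_iff_ne_top.2 hW)
  obtain ⟨F, hFf, hF⟩ : ∃ F : E →L[ℝ] ℝ, ‖F‖ = 1 ∧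
      ∀ x, x ∈ Submodule.span ℤ (Set.range b) → ‖x‖ ≤ r + T * r * 2 → F x = 0 := by
    have h0 : LinearMap.toContinuousLinearMap f ≠ 0 := by simpa using hf0
    refine ⟨‖LinearMap.toContinuousLinearMap f‖⁻¹ • LinearMap.toContinuousLinearMap f, ?_, ?_⟩
    · rw [norm_smul, norm_inv, norm_norm, inv_mul_cancel₀ (norm_ne_zero_iff.2 h0)]
    · intro x hx hxR
      have : f x = 0 := hf (Submodule.subset_span ⟨hx, hxR⟩)
      simp [this]
  obtain ⟨t, ht, hFt⟩ : ∃ t : E, ‖t‖ ≤ 2 ∧ F t = 1 := by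
    obtain ⟨s, hs, hFs⟩ := F.exists_lt_apply_of_lt_opNorm (r := 1 / 2) (by rw [hFf]; norm_num)
    have h0 : F s ≠ 0 := by
      intro h; rw [h, norm_zero] at hFs; linarith
    refine ⟨(F s)⁻¹ • s, ?_, by simp [h0]⟩
    rw [norm_smul, norm_inv]
    calc ‖F s‖⁻¹ * ‖s‖ ≤ (1 / 2)⁻¹ * 1 := by gcongr
      _ = 2 := by norm_num
  have hT0 : (T : ℝ) ≠ 0 := by
    rintro h
    rw [Nat.cast_eq_zero] at h
    simp [h] at hT
  set g : E →ₗ[ℝ] E := LinearMap.transvection (F : E →ₗ[ℝ] ℝ) (((T : ℝ) - 1) • t) with hg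
  have hgx (x : E) : g x = x + F x • ((T : ℝ) - 1) • t := by
    simp [hg, LinearMap.transvection.apply]
  have hFg (x : E) : F (g x) = T * F x := by
    rw [hgx]; simp [hFt]; ring
  have hdet : g.det = T := by
    rw [hg, LinearMap.transvection.det]; simp [hFt]
  have : Countable (Submodule.span ℤ (Set.range b)).toAddSubgroup :=
    inferInstanceAs (Countable (Submodule.span ℤ (Set.range b)))
  obtain ⟨x, hx0, hx⟩ := exists_ne_zero_mem_lattice_of_measure_mul_two_pow_lt_measure (μ := μ)
    (ZSpan.isAddFundamentalDomain' b μ) (s := g '' Metric.ball 0 r)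
    (by
      rintro _ ⟨y, hy, rfl⟩
      exact ⟨-y, by simpa using hy, by simp⟩)
    ((convex_ball 0 r).linear_image g)
    (by
      rw [Measure.addHaar_image_linearMap, hdet]
      refine lt_of_le_of_lt (by gcongr) (hT.trans_eq ?_)
      simp)
  obtain ⟨y, hy, hyx⟩ := hx
  rw [mem_ball_zero_iff] at hy
  have hFy : ‖F y‖ ≤ ‖y‖ := by simpa [hFf] using F.le_opNorm y
  have hT1 : (1 : ℝ) ≤ T := by
    have : T ≠ 0 := by exact_mod_cast hT0
    exact_mod_cast Nat.one_le_iff_ne_zero.2 this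
  have hnorm : ‖(x : E)‖ ≤ r + T * r * 2 := by
    rw [← hyx, hgx]
    refine (norm_add_le _ _).trans ?_
    rw [norm_smul, norm_smul, Real.norm_of_nonneg (by linarith : (0 : ℝ) ≤ T - 1)]
    have h1 : ‖F y‖ * (((T : ℝ) - 1) * ‖t‖) ≤ r * (T * 2) := by
      gcongr
      · exact hFy.trans hy.le
      · linarith
    linarith
  have hFx := hF x x.2 hnorm
  rw [← hyx, hFg, mul_eq_zero, or_iff_right hT0] at hFx
  rw [hgx, hFx, zero_smul, add_zero] at hyx
  have := hmin x x.2 (by simpa using hx0)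
  rw [← hyx] at this
  linarith

theorem Ultrafilter.exists_tendsto_of_eventually_mem {α X : Type*} [TopologicalSpace X] {K : Set X}
    (hK : IsCompact K) (G : Ultrafilter α) {f : α → X} (h : ∀ᶠ a in G, f a ∈ K) :
    ∃ x ∈ K, Tendsto f G (𝓝 x) :=
  hK.ultrafilter_le_nhds (G.map f) (le_principal_iff.2 h)

theorem exists_basis_span_int_eq {E : Type*} [NormedAddCommGroup E] [NormedSpace ℝ E]
    {ι : Type} [Fintype ι] (c₀ : Basis ι ℝ E) (L : Submodule ℤ E) [DiscreteTopology L]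
    [IsZLattice ℝ L] : ∃ b : Basis ι ℝ E, Submodule.span ℤ (Set.range b) = L := by
  have : FiniteDimensional ℝ E := c₀.finiteDimensional_of_finite
  have := ZLattice.module_free ℝ L
  let b := Free.chooseBasis ℤ L
  refine ⟨(b.ofZLatticeBasis ℝ L).reindex ((b.ofZLatticeBasis ℝ L).indexEquiv c₀), ?_⟩
  rw [Basis.range_reindex, Basis.ofZLatticeBasis_span]

theorem one_le_abs_det_of_mem_span_int {E : Type*} [AddCommGroup E] [Module ℝ E]
    {ι : Type} [Fintype ι] [DecidableEq ι] (b : Basis ι ℝ E) {v : ι → E}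
    (hv : ∀ i, v i ∈ Submodule.span ℤ (Set.range b)) (hli : LinearIndependent ℝ v) :
    1 ≤ |b.det v| := by
  have hint (i j) : ∃ n : ℤ, (n : ℝ) = b.repr (v j) i := by
    simpa using (b.mem_span_iff_repr_mem ℤ (v j)).1 (hv j) i
  choose M hM using hint
  have hdet : b.det v = ((Matrix.of M).det : ℤ) := by
    rw [Basis.det_apply, Int.cast_det]
    congr 1
    ext i j
    simp [Basis.toMatrix_apply, hM]
  have : FiniteDimensional ℝ E := b.finiteDimensional_of_finite
  have hne : b.det v ≠ 0 := by
    have := (b.is_basis_iff_det (v := v)).1 ⟨hli,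
      hli.span_eq_top_of_card_eq_finrank' (finrank_eq_card_basis b).symm⟩
    exact this.ne_zero
  rw [hdet] at hne ⊢
  rw [← Int.cast_abs]
  exact_mod_cast Int.one_le_abs (by exact_mod_cast hne)

theorem exists_linearIndependent_of_span_eq_top {K E : Type*} [Field K]
    [AddCommGroup E] [Module K E]
    {ι : Type} (c₀ : Basis ι K E) {s : Set E} (hs : Submodule.span K s = ⊤) :
    ∃ v : ι → E, LinearIndependent K v ∧ ∀ i, v i ∈ s := by
  let b := Basis.ofSpan hs.ge
  let e := b.indexEquiv c₀
  refine ⟨b.reindex e, (b.reindex e).linearIndependent, fun i => ?_⟩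
  exact Basis.ofSpan_subset hs.ge ⟨e.symm i, by simp [b]⟩

/-- The limits of the sections of a family of additive subgroups along a filter. -/
def Submodule.limits {E α : Type*} [NormedAddCommGroup E] (G : Filter α)
    (L : α → Submodule ℤ E) : Submodule ℤ E where
  carrier := {x | ∃ l : α → E, (∀ᶠ a in G, l a ∈ L a) ∧ Tendsto l G (𝓝 x)}
  add_mem' := by
    rintro x y ⟨l, hl, hlx⟩ ⟨m, hm, hmy⟩
    exact ⟨l + m, by filter_upwards [hl, hm] with a h1 h2 using add_mem h1 h2, hlx.add hmy⟩
  zero_mem' := ⟨0, by simp, tendsto_const_nhds⟩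
  smul_mem' := by
    rintro n x ⟨l, hl, hlx⟩
    exact ⟨n • l, by filter_upwards [hl] with a h1 using (L a).smul_mem n h1, hlx.const_smul n⟩

/-- A section converging to a point of norm less than `r` is eventually zero. -/
theorem Submodule.discreteTopology_limits {E α : Type*} [NormedAddCommGroup E] {G : Filter α}
    [G.NeBot] {L : α → Submodule ℤ E} {r : ℝ} (hr : 0 < r)
    (hmin : ∀ᶠ a in G, ∀ x ∈ L a, x ≠ 0 → r ≤ ‖x‖) : DiscreteTopology (Submodule.limits G L) := by
  refine discreteTopology_of_isOpen_singleton_zero ?_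
  have : ({0} : Set (Submodule.limits G L)) = Subtype.val ⁻¹' Metric.ball (0 : E) r := by
    ext ⟨x, hx⟩
    simp only [Set.mem_singleton_iff, Submodule.mk_eq_zero, Set.mem_preimage,
      mem_ball_zero_iff]
    refine ⟨fun h => by simpa [h] using hr, fun h => ?_⟩
    obtain ⟨l, hl, hlx⟩ := hx
    refine tendsto_nhds_unique hlx (tendsto_const_nhds.congr' ?_)
    filter_upwards [hl, hmin, hlx.norm.eventually_lt_const h] with a h1 h2 h3
    by_contra h0
    exact (h2 _ h1 (Ne.symm h0)).not_gt h3
  rw [this]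
  exact Metric.isOpen_ball.preimage continuous_subtype_val

/-- Round the coordinates of a point of `L` outside the sublattice to the nearest integers and keep
the remainder. -/
theorem exists_half_box_mem_of_span_int_lt {E : Type*} [NormedAddCommGroup E] [NormedSpace ℝ E]
    {ι : Type} [Fintype ι] (c : Basis ι ℝ E) {L : Submodule ℤ E} (hc : ∀ i, c i ∈ L)
    (hne : Submodule.span ℤ (Set.range c) ≠ L) :
    ∃ t : ι → ℝ, (∀ i, |t i| ≤ 1 / 2) ∧ ∑ i, t i • c i ∈ L ∧ ∑ i, t i • c i ≠ 0 := by
  have hle : Submodule.span ℤ (Set.range c) ≤ L := by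
    rw [Submodule.span_le]; rintro _ ⟨i, rfl⟩; exact hc i
  obtain ⟨x, hxL, hx⟩ := SetLike.exists_of_lt (lt_of_le_of_ne hle hne)
  have hsum : ∑ i, (c.repr x i - round (c.repr x i)) • c i
      = x - ∑ i, round (c.repr x i) • c i := by
    simp_rw [sub_smul, Finset.sum_sub_distrib, Int.cast_smul_eq_zsmul, c.sum_repr]
  have hmem : ∑ i, round (c.repr x i) • c i ∈ Submodule.span ℤ (Set.range c) :=
    Submodule.sum_mem _ fun i _ => Submodule.smul_mem _ _ (Submodule.subset_span ⟨i, rfl⟩)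
  refine ⟨fun i => c.repr x i - round (c.repr x i), fun i => abs_sub_round _, ?_, ?_⟩
  · rw [hsum]; exact sub_mem hxL (hle hmem)
  · rw [hsum]; intro h; rw [sub_eq_zero.1 h] at hx; exact hx hmem

/-- **Mahler's compactness criterion**, along an ultrafilter. -/
theorem exists_tendsto_basis_of_minimum_le {E : Type*} [NormedAddCommGroup E] [NormedSpace ℝ E]
    {ι : Type} [Fintype ι] [DecidableEq ι] (c₀ : Basis ι ℝ E) {α : Type*} (G : Ultrafilter α)
    (B : α → Basis ι ℝ E) (hdet : ∀ a, |c₀.det (B a)| = 1) {r : ℝ} (hr : 0 < r)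
    (hmin : ∀ᶠ a in G, ∀ x ∈ Submodule.span ℤ (Set.range (B a)), x ≠ 0 → r ≤ ‖x‖) :
    ∃ (c : α → ι → E) (c' : ι → E), Tendsto c G (𝓝 c') ∧ LinearIndependent ℝ c' ∧
      ∀ᶠ a in G, LinearIndependent ℝ (c a) ∧
        Submodule.span ℤ (Set.range (c a)) = Submodule.span ℤ (Set.range (B a)) := by
  have : FiniteDimensional ℝ E := c₀.finiteDimensional_of_finite
  let _ : MeasurableSpace E := borel E
  have : BorelSpace E := ⟨rfl⟩
  let μ : Measure E := Measure.addHaar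
  set L : α → Submodule ℤ E := fun a => Submodule.span ℤ (Set.range (B a))
  obtain ⟨R, hR⟩ := exists_span_shortVectors_eq_top μ
    (V := μ (ZSpan.fundamentalDomain c₀)) (ZSpan.fundamentalDomain_isBounded c₀).measure_lt_top.ne hr
  have hvex : ∀ᶠ a in G, ∃ v : ι → E, LinearIndependent ℝ v ∧ ∀ i, v i ∈ L a ∧ ‖v i‖ ≤ R := by
    filter_upwards [hmin] with a ha
    refine exists_linearIndependent_of_span_eq_top c₀ (hR (B a) ?_ ha)
    rw [ZSpan.measure_fundamentalDomain (B a) μ c₀, hdet]; simp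
  obtain ⟨v, hv⟩ := hvex.choice
  obtain ⟨v', -, hv'⟩ := G.exists_tendsto_of_eventually_mem
    (isCompact_univ_pi fun _ : ι => isCompact_closedBall (0 : E) R) (f := v) (by
      filter_upwards [hv] with a ha i _ using by simpa using (ha.2 i).2)
  -- Independent lattice vectors have nonzero integral determinant in a lattice basis. The bound 1
  -- survives the limit, so the limit vectors stay independent.
  have hv'det : 1 ≤ |c₀.det v'| := by
    have hcont : Continuous fun w : ι → E => c₀.det w := by
      simp_rw [Basis.det_apply]
      refine Continuous.matrix_det (continuous_matrix fun i j => ?_)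
      exact ((c₀.coord i).continuous_of_finiteDimensional).comp (continuous_apply j)
    refine ge_of_tendsto ((hcont.tendsto v').comp hv').abs ?_
    filter_upwards [hv] with a ha
    let w := basisOfLinearIndependentOfCardEqFinrank' _ ha.1 (finrank_eq_card_basis c₀).symm
    have hw : ⇑w = v a := coe_basisOfLinearIndependentOfCardEqFinrank' _ _ _
    have := c₀.det_mul_det (B a) w
    rw [hw] at this
    rw [Function.comp_apply, ← this, abs_mul, hdet, one_mul]
    exact one_le_abs_det_of_mem_span_int (B a) (fun i => (ha.2 i).1) ha.1
  have hv'span : Submodule.span ℝ (Set.range v') = ⊤ := by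
    refine ((c₀.is_basis_iff_det).2 ?_).2
    rw [isUnit_iff_ne_zero]
    intro h
    rw [h] at hv'det
    norm_num at hv'det
  set Λ := Submodule.limits (G : Filter α) L
  have : DiscreteTopology Λ := Submodule.discreteTopology_limits hr hmin
  have : IsZLattice ℝ Λ := ⟨by
    rw [eq_top_iff, ← hv'span]
    refine Submodule.span_mono ?_
    rintro _ ⟨i, rfl⟩
    exact ⟨fun a => v a i, by filter_upwards [hv] with a ha using (ha.2 i).1,
      (tendsto_pi_nhds.1 hv') i⟩⟩
  obtain ⟨c', hc'⟩ := exists_basis_span_int_eq c₀ Λ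
  have hcex (i : ι) : c' i ∈ Λ := hc' ▸ Submodule.subset_span ⟨i, rfl⟩
  choose l hlmem hl using hcex
  have hlim : Tendsto (fun a i => l i a) G (𝓝 c') := tendsto_pi_nhds.2 hl
  have hli : ∀ᶠ a in G, LinearIndependent ℝ fun i => l i a :=
    hlim.eventually c'.linearIndependent.eventually
  refine ⟨fun a i => l i a, c', hlim, c'.linearIndependent, hli.and ?_⟩
  -- If the lifted basis spans a proper sublattice, a nonzero lattice point has coordinates at most
  -- 1/2. The limit coordinates are integers, hence zero, so these points tend to 0, against the
  -- lower bound `r`.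
  by_contra hnot
  rw [← Ultrafilter.eventually_not] at hnot
  have htex : ∀ᶠ a in G, ∃ t : ι → ℝ, (∀ i, |t i| ≤ 1 / 2) ∧ ∑ i, t i • l i a ∈ L a ∧
      ∑ i, t i • l i a ≠ 0 := by
    filter_upwards [hnot, hli, eventually_all.2 hlmem] with a h1 h2 h3
    let c := basisOfLinearIndependentOfCardEqFinrank' _ h2 (finrank_eq_card_basis c₀).symm
    simpa [c] using exists_half_box_mem_of_span_int_lt c (L := L a) (by simpa [c] using h3)
      (by simpa [c] using h1)
  obtain ⟨t, ht⟩ := htex.choice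
  obtain ⟨t', ht'mem, ht'⟩ := G.exists_tendsto_of_eventually_mem
    (isCompact_univ_pi fun _ : ι => isCompact_Icc (a := -(1 / 2 : ℝ)) (b := 1 / 2)) (f := t) (by
      filter_upwards [ht] with a ha i _ using abs_le.1 (ha.1 i))
  have hsum : Tendsto (fun a => ∑ i, t a i • l i a) G (𝓝 (∑ i, t' i • c' i)) :=
    tendsto_finsetSum _ fun i _ => ((tendsto_pi_nhds.1 ht') i).smul (hl i)
  have hsumΛ : ∑ i, t' i • c' i ∈ Λ :=
    ⟨_, by filter_upwards [ht] with a ha using ha.2.1, hsum⟩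
  have ht'0 : t' = 0 := by
    funext i
    rw [← hc', c'.mem_span_iff_repr_mem ℤ] at hsumΛ
    obtain ⟨n, hn⟩ := hsumΛ i
    rw [Basis.repr_sum_self] at hn
    have h1 := abs_le.2 (ht'mem i trivial)
    rw [← hn] at h1 ⊢
    have : |n| < 1 := by
      have : |(n : ℝ)| < 1 := h1.trans_lt (by norm_num)
      exact_mod_cast this
    simp [Int.abs_lt_one_iff.1 this]
  rw [ht'0] at hsum
  have := ge_of_tendsto hsum.norm (b := r) (by
    filter_upwards [ht, hmin] with a ha hm using hm _ ha.2.1 ha.2.2)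
  simp at this
  linarith

/-! ### Small elements of discrete groups -/

theorem norm_inv_le_two_of_norm_sub_one_le {R : Type*} [NormedRing R] [NormOneClass R] (a : Rˣ)
    (ha : ‖(a : R) - 1‖ ≤ 1 / 16) : ‖((a⁻¹ : Rˣ) : R)‖ ≤ 2 := by
  have h : ((a⁻¹ : Rˣ) : R) = 1 - (a - 1) * ((a⁻¹ : Rˣ) : R) := by
    rw [sub_mul, Units.mul_inv]; simp
  have h1 : ‖((a⁻¹ : Rˣ) : R)‖ ≤ 1 + 1 / 16 * ‖((a⁻¹ : Rˣ) : R)‖ := by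
    conv_lhs => rw [h]
    refine (norm_sub_le _ _).trans ?_
    rw [norm_one]
    gcongr
    refine (norm_mul_le _ _).trans ?_
    gcongr
  linarith

theorem norm_commutator_sub_one_le_half {R : Type*} [NormedRing R] [NormOneClass R] (a b : Rˣ)
    (ha : ‖(a : R) - 1‖ ≤ 1 / 16) (hb : ‖(b : R) - 1‖ ≤ 1 / 16) :
    ‖((⁅a, b⁆ : Rˣ) : R) - 1‖ ≤ ‖(b : R) - 1‖ / 2 := by
  rw [commutatorElement_def]
  calc _ ≤ 2 * ‖((a⁻¹ : Rˣ) : R)‖ * ‖((b⁻¹ : Rˣ) : R)‖ * ‖(a : R) - 1‖ * ‖(b : R) - 1‖ :=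
        norm_commutator_units_sub_one_le a b
    _ ≤ 2 * 2 * 2 * (1 / 16) * ‖(b : R) - 1‖ := by
        gcongr
        · exact norm_inv_le_two_of_norm_sub_one_le a ha
        · exact norm_inv_le_two_of_norm_sub_one_le b hb
    _ = ‖(b : R) - 1‖ / 2 := by ring

/-- A form of **Zassenhaus' theorem**: small elements of a discrete group have a common nontrivial
small commuting element. -/
theorem exists_commute_of_norm_sub_one_le {R Q : Type*} [NormedRing R] [NormOneClass R] [Group Q]
    (φ : Q →* Rˣ) (Γ : Subgroup Q) {ε : ℝ} (hε : 0 < ε)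
    (hΓ : ∀ γ ∈ Γ, ‖(φ γ : R) - 1‖ < ε → γ = 1) {S : Set Q} (hSΓ : S ⊆ Γ)
    (hS : ∀ g ∈ S, ‖(φ g : R) - 1‖ ≤ 1 / 16) (hne : ∃ g ∈ S, g ≠ 1) :
    ∃ z ∈ Γ, z ≠ 1 ∧ ‖(φ z : R) - 1‖ ≤ 1 / 16 ∧ ∀ g ∈ S, Commute g z := by
  set T : Set ℝ := {t | ∃ γ ∈ Γ, γ ≠ 1 ∧ ‖(φ γ : R) - 1‖ ≤ 1 / 16 ∧ t = ‖(φ γ : R) - 1‖} with hT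
  have hTne : T.Nonempty := by
    obtain ⟨g, hg, hg1⟩ := hne
    exact ⟨_, g, hSΓ hg, hg1, hS g hg, rfl⟩
  have hTε : ∀ t ∈ T, ε ≤ t := by
    rintro _ ⟨γ, hγ, hγ1, -, rfl⟩
    by_contra! h
    exact hγ1 (hΓ γ hγ h)
  have hm : ε ≤ sInf T := le_csInf hTne hTε
  -- The infimum need not be attained: `z` within a factor 2 of it suffices, since a nontrivial
  -- commutator with `z` would be at most half as far from 1.
  obtain ⟨_, ⟨z, hz, hz1, hzs, rfl⟩, hlt⟩ :=
    exists_lt_of_csInf_lt hTne (show sInf T < 2 * sInf T by linarith)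
  refine ⟨z, hz, hz1, hzs, fun g hg => ?_⟩
  by_contra hc
  have hcomm : ⁅g, z⁆ ≠ 1 := fun h => hc (commutatorElement_eq_one_iff_commute.1 h)
  have hle := norm_commutator_sub_one_le_half (φ g) (φ z) (hS g hg) hzs
  rw [← map_commutatorElement] at hle
  have := csInf_le ⟨ε, hTε⟩ (show ‖(φ ⁅g, z⁆ : R) - 1‖ ∈ T from
    ⟨⁅g, z⁆, Γ.commutator_le_self (Subgroup.commutator_mem_commutator (hSΓ hg) hz), hcomm, hle.trans
      (by linarith), rfl⟩)
  linarith

/-- The scalar is a cube root of unity, and the primitive ones are far from 1. -/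
theorem Matrix.SpecialLinearGroup.eq_one_of_val_eq_smul_one {z : SL(3, ℂ)} {c : ℂ}
    (hz : (z : Matrix (Fin 3) (Fin 3) ℂ) = c • 1) (hc : ‖c - 1‖ ≤ 1 / 16) : z = 1 := by
  have hdet : c ^ 3 = 1 := by
    have := z.2
    rw [hz, Matrix.det_smul, Matrix.det_one] at this
    simpa using this
  have hc1 : c = 1 := by
    by_contra h
    have h0 : c ^ 2 + c + 1 = 0 := by
      have : (c - 1) * (c ^ 2 + c + 1) = 0 := by linear_combination hdet
      exact (mul_eq_zero.1 this).resolve_left (sub_ne_zero.2 h)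
    have h3 : (3 : ℂ) = -((c - 1) * (c - 1) + 3 * (c - 1)) := by linear_combination h0
    have h4 : (3 : ℝ) ≤ 1 / 16 * (1 / 16) + 3 * (1 / 16) := by
      calc (3 : ℝ) = ‖(3 : ℂ)‖ := by simp
        _ = ‖(c - 1) * (c - 1) + 3 * (c - 1)‖ := by conv_lhs => rw [h3, norm_neg]
        _ ≤ ‖c - 1‖ * ‖c - 1‖ + 3 * ‖c - 1‖ := by
          refine (norm_add_le _ _).trans_eq ?_
          simp
        _ ≤ _ := by gcongr
    norm_num at h4
  exact Subtype.ext (by rw [hz, hc1, one_smul]; rfl)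

theorem Subgroup.exists_norm_sub_one_lt_of_discreteTopology (Γ : Subgroup SL(3, ℂ))
    [DiscreteTopology Γ] :
    ∃ ε > 0, ∀ γ ∈ Γ, ‖(γ : Matrix (Fin 3) (Fin 3) ℂ) - 1‖ < ε → γ = 1 := by
  obtain ⟨U, hU, hU1⟩ := isOpen_induced_iff.1 (isOpen_discrete ({1} : Set Γ))
  obtain ⟨V, hV, rfl⟩ := isOpen_induced_iff.1 hU
  have h1 : (1 : Matrix (Fin 3) (Fin 3) ℂ) ∈ V := by
    have : (1 : Γ) ∈ Subtype.val ⁻¹' (Subtype.val ⁻¹' V : Set SL(3, ℂ)) := by rw [hU1]; rfl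
    exact this
  obtain ⟨ε, hε, hball⟩ := Metric.isOpen_iff.1 hV 1 h1
  refine ⟨ε, hε, fun γ hγ hlt => ?_⟩
  have : (⟨γ, hγ⟩ : Γ) ∈ ({1} : Set Γ) := by
    rw [← hU1]
    exact hball (by rwa [mem_ball_iff_norm])
  exact congrArg Subtype.val this

theorem Subgroup.discreteTopology_of_norm_sub_one_lt {Γ : Subgroup SL(3, ℂ)} {ε : ℝ} (hε : 0 < ε)
    (h : ∀ γ ∈ Γ, ‖(γ : Matrix (Fin 3) (Fin 3) ℂ) - 1‖ < ε → γ = 1) : DiscreteTopology Γ := by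
  refine discreteTopology_of_isOpen_singleton_one ?_
  refine isOpen_induced_iff.2 ⟨Subtype.val ⁻¹' Metric.ball (1 : Matrix (Fin 3) (Fin 3) ℂ) ε,
    Metric.isOpen_ball.preimage continuous_subtype_val, ?_⟩
  ext ⟨γ, hγ⟩
  refine ⟨fun hlt => Subtype.ext (h γ hγ (mem_ball_iff_norm.1 hlt)), fun h1 => ?_⟩
  obtain rfl : γ = 1 := congrArg Subtype.val h1
  exact Metric.mem_ball_self hε

/-- The conjugate by `p` of the inclusion of `SL(3, ℂ)` in the group of invertible matrices. -/
noncomputable def conjIncl (p : (Matrix (Fin 3) (Fin 3) ℂ)ˣ) :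
    SL(3, ℂ) →* (Matrix (Fin 3) (Fin 3) ℂ)ˣ :=
  (MulAut.conj p).toMonoidHom.comp Matrix.SpecialLinearGroup.toGL

theorem coe_conjIncl (p : (Matrix (Fin 3) (Fin 3) ℂ)ˣ) (g : SL(3, ℂ)) :
    (conjIncl p g : Matrix (Fin 3) (Fin 3) ℂ) = p * g * (p⁻¹ : (Matrix (Fin 3) (Fin 3) ℂ)ˣ) := rfl

theorem coe_conjIncl_sub_one (p : (Matrix (Fin 3) (Fin 3) ℂ)ˣ) (g : SL(3, ℂ)) :
    (conjIncl p g : Matrix (Fin 3) (Fin 3) ℂ) - 1 =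
      p * (g - 1) * (p⁻¹ : (Matrix (Fin 3) (Fin 3) ℂ)ˣ) := by
  rw [coe_conjIncl, mul_sub, sub_mul, mul_one, Units.mul_inv]

/-- Otherwise Zassenhaus' theorem yields a nontrivial small element centralizing `S`, which is
scalar and so trivial. Smallness is measured after conjugation by `p`, and the constant 1/16 does
not depend on `p`: this permits rescaling. -/
theorem Subgroup.eq_one_of_small_of_centralizer_scalar (Γ : Subgroup SL(3, ℂ)) [DiscreteTopology Γ]
    (p : (Matrix (Fin 3) (Fin 3) ℂ)ˣ) {S : Set SL(3, ℂ)} (hSΓ : S ⊆ Γ)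
    (hsmall : ∀ g ∈ S, ‖(conjIncl p g : Matrix (Fin 3) (Fin 3) ℂ) - 1‖ ≤ 1 / 16)
    (hS : ∀ z : Matrix (Fin 3) (Fin 3) ℂ, (∀ g ∈ S, Commute (g : Matrix (Fin 3) (Fin 3) ℂ) z) →
      ∃ c : ℂ, z = c • 1) : ∀ g ∈ S, g = 1 := by
  by_contra! hne
  obtain ⟨ε, hε, hΓ⟩ := Γ.exists_norm_sub_one_lt_of_discreteTopology
  set C := ‖((p⁻¹ : (Matrix (Fin 3) (Fin 3) ℂ)ˣ) : Matrix (Fin 3) (Fin 3) ℂ)‖ *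
    ‖(p : Matrix (Fin 3) (Fin 3) ℂ)‖ + 1 with hC
  have hC0 : 0 < C := by positivity
  obtain ⟨z, -, hz1, hzs, hcomm⟩ := exists_commute_of_norm_sub_one_le (conjIncl p) Γ
    (ε := ε / C) (by positivity) (fun γ hγ hlt => hΓ γ hγ (by
      have : (γ : Matrix (Fin 3) (Fin 3) ℂ) - 1 =
          (p⁻¹ : (Matrix (Fin 3) (Fin 3) ℂ)ˣ) * (conjIncl p γ - 1) * p := by
        rw [coe_conjIncl_sub_one]
        simp [mul_assoc]
      rw [this, ← div_mul_cancel₀ ε hC0.ne']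
      refine lt_of_le_of_lt ((norm_mul_le _ _).trans
        (mul_le_mul_of_nonneg_right (norm_mul_le _ _) (norm_nonneg _))) ?_
      have h0 := norm_nonneg ((conjIncl p γ : Matrix (Fin 3) (Fin 3) ℂ) - 1)
      calc _ = ‖(conjIncl p γ : Matrix (Fin 3) (Fin 3) ℂ) - 1‖ * (C - 1) := by rw [hC]; ring
        _ ≤ ‖(conjIncl p γ : Matrix (Fin 3) (Fin 3) ℂ) - 1‖ * C := by gcongr; linarith
        _ < _ := by gcongr)) hSΓ hsmall hne
  obtain ⟨c, hc⟩ := hS z fun g hg => congrArg Subtype.val (hcomm g hg).eq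
  refine hz1 (Matrix.SpecialLinearGroup.eq_one_of_val_eq_smul_one hc ?_)
  have : (conjIncl p z : Matrix (Fin 3) (Fin 3) ℂ) - 1 = (c - 1) • 1 := by
    rw [coe_conjIncl, hc]
    simp [sub_smul]
  rwa [this, norm_smul, norm_one, mul_one] at hzs

/-! ### Subspaces of matrices stable under brackets -/

/-- When `n² = 0`, the double bracket `[n, [n, a]]` equals `-2nan`. -/
theorem Submodule.mul_mul_mem_of_commutator_mem {R : Type*} [Ring R] [Algebra ℂ R]
    {A : Submodule ℂ R} {n : R} (hn : n * n = 0) (h : ∀ a ∈ A, n * a - a * n ∈ A) {a : R}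
    (ha : a ∈ A) : n * a * n ∈ A := by
  have h2 : n * (n * a - a * n) - (n * a - a * n) * n = (-2 : ℂ) • (n * a * n) := by
    have : n * (n * a - a * n) - (n * a - a * n) * n =
      (n * n) * a + a * (n * n) - 2 • (n * a * n) := by noncomm_ring
    rw [this, hn, ← Nat.cast_smul_eq_nsmul ℂ]
    simp
  have := h _ (h a ha)
  rw [h2] at this
  exact (A.smul_mem_iff (by norm_num)).1 this

open Matrix in
-- Double brackets isolate single entries, so a non-scalar element of `A` yields one matrix unit;
-- further brackets and the identity yield the others.
theorem Matrix.eq_top_of_commutator_single_mem {A : Submodule ℂ (Matrix (Fin 3) (Fin 3) ℂ)}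
    (i : Fin 3) (hr : ∀ j ≠ i, ∀ a ∈ A, single i j 1 * a - a * single i j 1 ∈ A)
    (hc : ∀ j ≠ i, ∀ a ∈ A, single j i 1 * a - a * single j i 1 ∈ A)
    (h1 : 1 ∈ A) (hA : ∃ a ∈ A, ∀ c : ℂ, a ≠ c • 1) : A = ⊤ := by
  have hrow (j) (hj : j ≠ i) (a) (ha : a ∈ A) (h0 : a j i ≠ 0) : single i j 1 ∈ A := by
    have := Submodule.mul_mul_mem_of_commutator_mem (by simp [hj]) (hr j hj) ha
    rw [single_mul_mul_single, one_mul, mul_one, ← mul_one (a j i), ← smul_eq_mul,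
      ← smul_single] at this
    exact (A.smul_mem_iff h0).1 this
  have hcol (j) (hj : j ≠ i) (a) (ha : a ∈ A) (h0 : a i j ≠ 0) : single j i 1 ∈ A := by
    have := Submodule.mul_mul_mem_of_commutator_mem (by simp [hj.symm]) (hc j hj) ha
    rw [single_mul_mul_single, one_mul, mul_one, ← mul_one (a i j), ← smul_eq_mul,
      ← smul_single] at this
    exact (A.smul_mem_iff h0).1 this
  -- Otherwise the off-diagonal entries of row and column `i` vanish throughout `A`. Applied also to
  -- the brackets of `a` with the units in row `i`, this makes `a` scalar.
  obtain ⟨j, hj, hij⟩ : ∃ j ≠ i, single i j 1 ∈ A := by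
    by_contra! hno
    have hr0 (j) (hj : j ≠ i) (a) (ha : a ∈ A) : a j i = 0 := by
      by_contra h0
      exact hno j hj (hrow j hj a ha h0)
    have hc0 (j) (hj : j ≠ i) (a) (ha : a ∈ A) : a i j = 0 := by
      by_contra h0
      exact hno j hj (hrow j hj _ (hcol j hj a ha h0) (by simp))
    obtain ⟨a, ha, hna⟩ := hA
    refine hna (a i i) ?_
    ext k l
    by_cases hk : k = i
    · subst hk
      by_cases hl : l = k
      · simp [hl]
      · simp [hc0 l hl a ha, Ne.symm hl]
    · by_cases hl : l = i
      · subst hl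
        simp [hr0 k hk a ha, hk]
      · have := hc0 l hl _ (hr k hk a ha)
        simp only [sub_apply, single_mul_apply_same, one_mul] at this
        by_cases hkl : k = l
        · subst hkl
          simp at this ⊢
          linear_combination this
        · rw [mul_single_apply_of_ne _ _ _ _ _ (Ne.symm hkl)] at this
          simpa [hkl] using this
  have hji : single j i 1 ∈ A := hcol j hj _ hij (by simp)
  obtain ⟨k, hki, hkj, hall⟩ : ∃ k, k ≠ i ∧ k ≠ j ∧ ∀ m, m = i ∨ m = j ∨ m = k := by
    clear * - hj
    revert i j; decide
  have hEkj : single k j 1 ∈ A := by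
    simpa [hkj.symm] using hc k hki _ hij
  have hEjk : single j k 1 ∈ A := by
    simpa [hkj, hkj.symm] using hr k hki _ hji
  have hik : single i k 1 ∈ A := by
    simpa [hki, hki.symm, hj.symm] using hr j hj _ hEjk
  have hki' : single k i 1 ∈ A := hcol k hki _ hik (by simp)
  have hdj : single j j 1 - single i i 1 ∈ A := by simpa using hc j hj _ hij
  have hdk : single k k 1 - single i i 1 ∈ A := by simpa using hc k hki _ hik
  have hone : (1 : Matrix (Fin 3) (Fin 3) ℂ) = single i i 1 + single j j 1 + single k k 1 := by
    ext a b
    rcases hall a with rfl | rfl | rfl <;> rcases hall b with rfl | rfl | rfl <;>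
      simp_all [eq_comm]
  -- Brackets only give trace-zero diagonal matrices; the identity supplies the missing direction.
  have hii : single i i 1 ∈ A := by
    have h3 : (3 : ℂ) • single i i (1 : ℂ) =
        1 - (single j j 1 - single i i 1) - (single k k 1 - single i i 1) := by
      rw [hone]; module
    refine (A.smul_mem_iff (by norm_num : (3 : ℂ) ≠ 0)).1 ?_
    rw [h3]
    exact A.sub_mem (A.sub_mem h1 hdj) hdk
  have hjj : single j j 1 ∈ A := by simpa using A.add_mem hdj hii
  have hkk : single k k 1 ∈ A := by simpa using A.add_mem hdk hii
  rw [eq_top_iff]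
  intro a _
  rw [matrix_eq_sum_single a]
  refine A.sum_mem fun p _ => A.sum_mem fun q _ => ?_
  have : single p q 1 ∈ A := by
    rcases hall p with rfl | rfl | rfl <;> rcases hall q with rfl | rfl | rfl <;> assumption
  simpa using A.smul_mem (a p q) this

/-! ### Lie algebras of the horospherical subgroups -/

namespace Horospherical

/-- The Lie algebra of `U`. -/
def plusLin (τ : PairType) : C2 →ₗ[ℂ] Matrix (Fin 3) (Fin 3) ℂ where
  toFun x := plusMat τ x - 1
  map_add' x y := by
    cases τ <;> ext i j <;> fin_cases i <;> fin_cases j <;> simp [plusMat]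
  map_smul' c x := by
    cases τ <;> ext i j <;> fin_cases i <;> fin_cases j <;> simp [plusMat]

/-- The Lie algebra of `U⁻`. -/
def minusLin (τ : PairType) : C2 →ₗ[ℂ] Matrix (Fin 3) (Fin 3) ℂ where
  toFun x := minusMat τ x - 1
  map_add' x y := by
    cases τ <;> ext i j <;> fin_cases i <;> fin_cases j <;> simp [minusMat]
  map_smul' c x := by
    cases τ <;> ext i j <;> fin_cases i <;> fin_cases j <;> simp [minusMat]

theorem plusLin_apply (τ : PairType) (x : C2) : plusLin τ x = plusMat τ x - 1 := rfl

theorem minusLin_apply (τ : PairType) (x : C2) : minusLin τ x = minusMat τ x - 1 := rfl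

theorem coe_uPlus (τ : PairType) (x : C2) :
    (uPlus τ (.ofAdd x) : Matrix (Fin 3) (Fin 3) ℂ) = 1 + plusLin τ x := by
  rw [plusLin_apply, add_sub_cancel]; rfl

theorem coe_uMinus (τ : PairType) (x : C2) :
    (uMinus τ (.ofAdd x) : Matrix (Fin 3) (Fin 3) ℂ) = 1 + minusLin τ x := by
  rw [minusLin_apply, add_sub_cancel]; rfl

/-- A one-parameter group in the centre of the Levi subgroup of `GL(3, ℂ)`. -/
noncomputable def scaling (τ : PairType) (t : ℂ) (ht : t ≠ 0) : (Matrix (Fin 3) (Fin 3) ℂ)ˣ :=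
  match τ with
  | .first => ⟨Matrix.diagonal ![t, 1, 1], Matrix.diagonal ![t⁻¹, 1, 1],
      by ext i j; fin_cases i <;> fin_cases j <;> simp [ht],
      by ext i j; fin_cases i <;> fin_cases j <;> simp [ht]⟩
  | .second => ⟨Matrix.diagonal ![1, 1, t⁻¹], Matrix.diagonal ![1, 1, t],
      by ext i j; fin_cases i <;> fin_cases j <;> simp [ht],
      by ext i j; fin_cases i <;> fin_cases j <;> simp [ht]⟩

theorem scaling_plusLin (τ : PairType) {t : ℂ} (ht : t ≠ 0) (x : C2) :
    (scaling τ t ht : Matrix (Fin 3) (Fin 3) ℂ) * plusLin τ x *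
      ((scaling τ t ht)⁻¹ : (Matrix (Fin 3) (Fin 3) ℂ)ˣ) = t • plusLin τ x := by
  rw [plusLin_apply]
  cases τ <;> ext i j <;> fin_cases i <;> fin_cases j <;>
    simp [plusMat, scaling, Units.inv_mk, mul_comm]

theorem scaling_minusLin (τ : PairType) {t : ℂ} (ht : t ≠ 0) (x : C2) :
    (scaling τ t ht : Matrix (Fin 3) (Fin 3) ℂ) * minusLin τ x *
      ((scaling τ t ht)⁻¹ : (Matrix (Fin 3) (Fin 3) ℂ)ˣ) = t⁻¹ • minusLin τ x := by
  rw [minusLin_apply]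
  cases τ <;> ext i j <;> fin_cases i <;> fin_cases j <;>
    simp [minusMat, scaling, Units.inv_mk, mul_comm]

/-- Commuting with the Lie algebra of `U` leaves a scalar plus an element of that Lie algebra; one
nonzero element of the opposite one removes the second term. -/
theorem exists_eq_smul_one_of_commute (τ : PairType) {z : Matrix (Fin 3) (Fin 3) ℂ}
    (hz : ∀ x, Commute (plusLin τ x) z) {y : C2} (hy : y ≠ 0) (hzy : Commute (minusLin τ y) z) :
    ∃ c : ℂ, z = c • 1 := by
  have hy' : y 0 ≠ 0 ∨ y 1 ≠ 0 := by
    by_contra! h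
    exact hy (by ext i; fin_cases i <;> simp [h])
  have h0 := (hz ![1, 0]).eq
  have h1 := (hz ![0, 1]).eq
  have h2 := hzy.eq
  rw [plusLin_apply] at h0 h1
  rw [minusLin_apply] at h2
  cases τ with
  | first =>
    have e0 := congrFun (congrFun h0 0) 0
    have e1 := congrFun (congrFun h0 0) 1
    have e2 := congrFun (congrFun h0 0) 2
    have e3 := congrFun (congrFun h1 0) 0
    have e4 := congrFun (congrFun h1 0) 1
    have e5 := congrFun (congrFun h1 0) 2
    have e6 := congrFun (congrFun h2 1) 1
    have e7 := congrFun (congrFun h2 1) 2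
    have e8 := congrFun (congrFun h2 2) 1
    have e9 := congrFun (congrFun h2 2) 2
    simp [plusMat, minusMat, Matrix.mul_apply, Fin.sum_univ_three] at e0 e1 e2 e3 e4 e5 e6 e7 e8 e9
    refine ⟨z 0 0, ?_⟩
    clear h0 h1 h2 hz hzy
    ext i j
    rcases hy' with h | h <;> fin_cases i <;> fin_cases j <;> simp_all
  | second =>
    have e0 := congrFun (congrFun h0 0) 0
    have e1 := congrFun (congrFun h0 0) 1
    have e2 := congrFun (congrFun h0 0) 2
    have e3 := congrFun (congrFun h0 1) 2
    have e4 := congrFun (congrFun h1 0) 2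
    have e5 := congrFun (congrFun h1 1) 2
    have e6 := congrFun (congrFun h2 0) 0
    have e7 := congrFun (congrFun h2 0) 1
    have e8 := congrFun (congrFun h2 1) 0
    have e9 := congrFun (congrFun h2 1) 1
    simp [plusMat, minusMat, Matrix.mul_apply, Fin.sum_univ_three] at e0 e1 e2 e3 e4 e5 e6 e7 e8 e9
    replace e3 := e3.symm
    replace e4 := e4.symm
    refine ⟨z 2 2, ?_⟩
    clear h0 h1 h2 hz hzy
    ext i j
    rcases hy' with h | h <;> fin_cases i <;> fin_cases j <;> simp_all

theorem eq_top_of_commutator_mem (τ : PairType) {A : Submodule ℂ (Matrix (Fin 3) (Fin 3) ℂ)}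
    (hp : ∀ x, ∀ a ∈ A, plusLin τ x * a - a * plusLin τ x ∈ A)
    (hm : ∀ x, ∀ a ∈ A, minusLin τ x * a - a * minusLin τ x ∈ A)
    (h1 : 1 ∈ A) (hA : ∃ a ∈ A, ∀ c : ℂ, a ≠ c • 1) : A = ⊤ := by
  cases τ with
  | first =>
    have e1 : plusLin .first ![1, 0] = Matrix.single 0 1 1 := by
      rw [plusLin_apply]; ext i j; fin_cases i <;> fin_cases j <;> simp [plusMat]
    have e2 : plusLin .first ![0, 1] = Matrix.single 0 2 1 := by
      rw [plusLin_apply]; ext i j; fin_cases i <;> fin_cases j <;> simp [plusMat]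
    have e3 : minusLin .first ![1, 0] = Matrix.single 1 0 1 := by
      rw [minusLin_apply]; ext i j; fin_cases i <;> fin_cases j <;> simp [minusMat]
    have e4 : minusLin .first ![0, 1] = Matrix.single 2 0 1 := by
      rw [minusLin_apply]; ext i j; fin_cases i <;> fin_cases j <;> simp [minusMat]
    refine Matrix.eq_top_of_commutator_single_mem 0 (fun j hj => ?_) (fun j hj => ?_) h1 hA
    · fin_cases j
      · exact absurd rfl hj
      · exact e1 ▸ hp ![1, 0]
      · exact e2 ▸ hp ![0, 1]
    · fin_cases j
      · exact absurd rfl hj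
      · exact e3 ▸ hm ![1, 0]
      · exact e4 ▸ hm ![0, 1]
  | second =>
    have e1 : plusLin .second ![1, 0] = Matrix.single 0 2 1 := by
      rw [plusLin_apply]; ext i j; fin_cases i <;> fin_cases j <;> simp [plusMat]
    have e2 : plusLin .second ![0, 1] = Matrix.single 1 2 1 := by
      rw [plusLin_apply]; ext i j; fin_cases i <;> fin_cases j <;> simp [plusMat]
    have e3 : minusLin .second ![1, 0] = Matrix.single 2 0 1 := by
      rw [minusLin_apply]; ext i j; fin_cases i <;> fin_cases j <;> simp [minusMat]
    have e4 : minusLin .second ![0, 1] = Matrix.single 2 1 1 := by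
      rw [minusLin_apply]; ext i j; fin_cases i <;> fin_cases j <;> simp [minusMat]
    refine Matrix.eq_top_of_commutator_single_mem 2 (fun j hj => ?_) (fun j hj => ?_) h1 hA
    · fin_cases j
      · exact e3 ▸ hm ![1, 0]
      · exact e4 ▸ hm ![0, 1]
      · exact absurd rfl hj
    · fin_cases j
      · exact e1 ▸ hp ![1, 0]
      · exact e2 ▸ hp ![0, 1]
      · exact absurd rfl hj


/-! ### Lattices, frames and the quotient topology -/

theorem uPlus_injective (τ : PairType) : Function.Injective (uPlus τ) := by
  intro x y h
  have h' : plusMat τ x.toAdd = plusMat τ y.toAdd := congrArg Subtype.val h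
  refine Multiplicative.toAdd.injective (funext fun i => ?_)
  cases τ with
  | first =>
    fin_cases i
    · simpa [plusMat] using congrFun (congrFun h' 0) 1
    · simpa [plusMat] using congrFun (congrFun h' 0) 2
  | second =>
    fin_cases i
    · simpa [plusMat] using congrFun (congrFun h' 0) 2
    · simpa [plusMat] using congrFun (congrFun h' 1) 2

theorem uMinus_injective (τ : PairType) : Function.Injective (uMinus τ) := by
  intro x y h
  have h' : minusMat τ x.toAdd = minusMat τ y.toAdd := congrArg Subtype.val h
  refine Multiplicative.toAdd.injective (funext fun i => ?_)
  cases τ with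
  | first =>
    fin_cases i
    · simpa [minusMat] using congrFun (congrFun h' 1) 0
    · simpa [minusMat] using congrFun (congrFun h' 2) 0
  | second =>
    fin_cases i
    · simpa [minusMat] using congrFun (congrFun h' 2) 0
    · simpa [minusMat] using congrFun (congrFun h' 2) 1

theorem finrank_C2 : finrank ℝ C2 = 4 := by
  simp [C2, finrank_pi_fintype, Complex.finrank_real_complex]

variable {u : Multiplicative C2 →* SL(3, ℂ)}

theorem mem_latticeOfFrame {b : Frame} {g : SL(3, ℂ)} :
    g ∈ (latticeOfFrame u b).1 ↔
      ∃ x ∈ Submodule.span ℤ (Set.range b.1), u (.ofAdd x) = g := by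
  constructor
  · rintro ⟨x, hx, rfl⟩
    exact ⟨x.toAdd, hx, rfl⟩
  · rintro ⟨x, hx, rfl⟩
    exact ⟨.ofAdd x, hx, rfl⟩

theorem latticeOfFrame_eq_of_span_eq {a b : Frame}
    (h : Submodule.span ℤ (Set.range a.1) = Submodule.span ℤ (Set.range b.1)) :
    latticeOfFrame u a = latticeOfFrame u b :=
  Subtype.ext (Subgroup.ext fun g => by
    rw [mem_latticeOfFrame, mem_latticeOfFrame, h])

theorem span_eq_of_latticeOfFrame_eq (hu : Function.Injective u) {a b : Frame}
    (h : latticeOfFrame u a = latticeOfFrame u b) :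
    Submodule.span ℤ (Set.range a.1) = Submodule.span ℤ (Set.range b.1) := by
  have key {a b : Frame} (h : latticeOfFrame u a = latticeOfFrame u b) :
      Submodule.span ℤ (Set.range a.1) ≤ Submodule.span ℤ (Set.range b.1) := by
    intro x hx
    have : u (.ofAdd x) ∈ (latticeOfFrame u a).1 := mem_latticeOfFrame.2 ⟨x, hx, rfl⟩
    rw [h, mem_latticeOfFrame] at this
    obtain ⟨y, hy, hyx⟩ := this
    rwa [← Multiplicative.ofAdd.injective (hu hyx)]
  exact le_antisymm (key h) (key h.symm)

theorem latticeOfFrame_surjective (u : Multiplicative C2 →* SL(3, ℂ)) :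
    Function.Surjective (latticeOfFrame u) := by
  rintro ⟨F, Λ, _, _, rfl⟩
  obtain ⟨b, hb⟩ := exists_basis_span_int_eq (finBasisOfFinrankEq ℝ C2 finrank_C2) Λ
  refine ⟨⟨b, b.linearIndependent⟩, Subtype.ext ?_⟩
  subst hb
  rfl

/-- Two bases of one lattice differ by an element of `GL(4, ℤ)`, which acts continuously on all
frames. -/
theorem exists_continuous_changeOfFrame {a b : Frame}
    (h : Submodule.span ℤ (Set.range a.1) = Submodule.span ℤ (Set.range b.1)) :
    ∃ T : Frame → Frame, Continuous T ∧ T a = b ∧ ∀ c : Frame,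
      Submodule.span ℤ (Set.range (T c).1) = Submodule.span ℤ (Set.range c.1) := by
  have h1 (i) : ∃ k : Fin 4 → ℤ, ∑ j, k j • a.1 j = b.1 i :=
    (Submodule.mem_span_range_iff_exists_fun ℤ).1 (h ▸ Submodule.subset_span ⟨i, rfl⟩)
  have h2 (i) : ∃ k : Fin 4 → ℤ, ∑ j, k j • b.1 j = a.1 i :=
    (Submodule.mem_span_range_iff_exists_fun ℤ).1 (h ▸ Submodule.subset_span ⟨i, rfl⟩)
  choose k hk using h1
  choose l hl using h2
  have comp (c : Fin 4 → C2) (i) :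
      ∑ j, l i j • ∑ m, k j m • c m = ∑ m, (Matrix.of l * Matrix.of k) i m • c m := by
    simp_rw [Finset.smul_sum, Matrix.mul_apply, Finset.sum_smul, mul_smul]
    rw [Finset.sum_comm]
    rfl
  have hlk : Matrix.of l * Matrix.of k = 1 := by
    ext i m
    have hZ : LinearIndependent ℤ a.1 := a.2.restrict_scalars' ℤ
    have : ∑ m, ((Matrix.of l * Matrix.of k) i m - (1 : Matrix _ _ ℤ) i m) • a.1 m = 0 := by
      simp_rw [sub_smul, Finset.sum_sub_distrib, ← comp, hk, hl]
      simp [Matrix.one_apply]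
    exact sub_eq_zero.1 (Fintype.linearIndependent_iff.1 hZ _ this m)
  have hinv (c : Fin 4 → C2) (i) : ∑ j, l i j • ∑ m, k j m • c m = c i := by
    rw [comp, hlk]
    simp [Matrix.one_apply]
  have hspan (c : Fin 4 → C2) : Submodule.span ℤ (Set.range fun i => ∑ j, k i j • c j) =
      Submodule.span ℤ (Set.range c) := by
    apply le_antisymm <;> rw [Submodule.span_le] <;> rintro _ ⟨i, rfl⟩
    · exact Submodule.sum_mem _ fun j _ => Submodule.smul_mem _ _ (Submodule.subset_span ⟨j, rfl⟩)
    · rw [← hinv c i]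
      exact Submodule.sum_mem _ fun j _ => Submodule.smul_mem _ _ (Submodule.subset_span ⟨j, rfl⟩)
  have hli (c : Frame) : LinearIndependent ℝ fun i => ∑ j, k i j • c.1 j := by
    refine linearIndependent_of_top_le_span_of_card_eq_finrank ?_ (by simp [finrank_C2])
    rw [← Submodule.span_span_of_tower ℤ, hspan, Submodule.span_span_of_tower,
      c.2.span_eq_top_of_card_eq_finrank' (by simp [finrank_C2])]
  refine ⟨fun c => ⟨_, hli c⟩, ?_, Subtype.ext (funext hk), fun c => hspan c.1⟩
  refine Continuous.subtype_mk (continuous_pi fun i => continuous_finsetSum _ fun j _ => ?_) _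
  exact (((continuous_apply j).comp continuous_subtype_val).const_smul (k i j))

/-- The closure of the preimage is invariant under change of basis, so its image is closed.
Convergence of lattices thereby lifts to convergence of bases. -/
theorem mem_closure_preimage_latticeOfFrame (hu : Function.Injective u) {S : Set (LatticeSpace u)}
    {b : Frame} (hb : latticeOfFrame u b ∈ closure S) :
    b ∈ closure (latticeOfFrame u ⁻¹' S) := by
  have hsat {a b : Frame} (ha : a ∈ closure (latticeOfFrame u ⁻¹' S))
      (hab : latticeOfFrame u a = latticeOfFrame u b) : b ∈ closure (latticeOfFrame u ⁻¹' S) := by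
    obtain ⟨T, hT, rfl, hTq⟩ := exists_continuous_changeOfFrame (span_eq_of_latticeOfFrame_eq hu hab)
    refine map_mem_closure hT ha fun c hc => ?_
    rwa [Set.mem_preimage, latticeOfFrame_eq_of_span_eq (hTq c)]
  have hclosed : IsClosed (latticeOfFrame u '' closure (latticeOfFrame u ⁻¹' S)) := by
    refine isClosed_coinduced.2 ?_
    convert! isClosed_closure (s := latticeOfFrame u ⁻¹' S)
    ext b
    exact ⟨fun ⟨a, ha, hab⟩ => hsat ha hab, fun h => ⟨b, h, rfl⟩⟩
  have hsub : S ⊆ latticeOfFrame u '' closure (latticeOfFrame u ⁻¹' S) := by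
    intro F hF
    obtain ⟨a, rfl⟩ := latticeOfFrame_surjective u F
    exact ⟨a, subset_closure hF, rfl⟩
  obtain ⟨a, ha, hab⟩ := closure_minimal hsub hclosed hb
  exact hsat ha hab

theorem continuous_latticeOfFrame (u : Multiplicative C2 →* SL(3, ℂ)) :
    Continuous (latticeOfFrame u) := continuous_coinduced_rng

/-- The action of `H` on `U⁻` by conjugation, as a matrix. -/
def minusAct (τ : PairType) (A : SL(2, ℂ)) : Matrix (Fin 2) (Fin 2) ℂ :=
  match τ with
  | .first => A
  | .second => ((A⁻¹ : SL(2, ℂ)) : Matrix (Fin 2) (Fin 2) ℂ).transpose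

theorem det_minusAct (τ : PairType) (A : SL(2, ℂ)) : (minusAct τ A).det = 1 := by
  cases τ
  · exact A.2
  · exact (Matrix.det_transpose _).trans A⁻¹.2

theorem leviEmb_mul_uMinus (τ : PairType) (A : SL(2, ℂ)) (y : C2) :
    leviEmb τ A * uMinus τ (.ofAdd y) * (leviEmb τ A)⁻¹ =
      uMinus τ (.ofAdd ((minusAct τ A).mulVec y)) := by
  rw [mul_inv_eq_iff_eq_mul]
  refine Subtype.ext ?_
  change leviMat τ A.1 * minusMat τ y = minusMat τ ((minusAct τ A).mulVec y) * leviMat τ A.1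
  have hA := A.2
  rw [Matrix.det_fin_two] at hA
  cases τ <;> ext i j <;> fin_cases i <;> fin_cases j <;>
    simp [leviMat, minusMat, minusAct, Matrix.mulVec, dotProduct, Matrix.mul_apply,
      Fin.sum_univ_three, Matrix.adjugate_fin_two] <;> first
      | linear_combination (-y 0) * hA
      | linear_combination (-y 1) * hA

end Horospherical

/-! ### Discreteness of limit groups -/

theorem LinearMap.exists_pos_norm_le {E F : Type*} [NormedAddCommGroup E] [NormedSpace ℂ E]
    [FiniteDimensional ℂ E] [NormedAddCommGroup F] [NormedSpace ℂ F] (f : E →ₗ[ℂ] F) :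
    ∃ K > 0, ∀ x, ‖f x‖ ≤ K * ‖x‖ :=
  (LinearMap.toContinuousLinearMap f).bound

/-- The limits of the sections of a family of subgroups along a filter. -/
def Subgroup.limits {Q α : Type*} [Group Q] [TopologicalSpace Q] [IsTopologicalGroup Q]
    (G : Filter α) (Γ : α → Subgroup Q) : Subgroup Q where
  carrier := {x | ∃ l : α → Q, (∀ᶠ a in G, l a ∈ Γ a) ∧ Tendsto l G (𝓝 x)}
  mul_mem' := by
    rintro x y ⟨l, hl, hlx⟩ ⟨m, hm, hmy⟩
    exact ⟨l * m, by filter_upwards [hl, hm] with a h1 h2 using mul_mem h1 h2, hlx.mul hmy⟩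
  one_mem' := ⟨1, by simp [one_mem], tendsto_const_nhds⟩
  inv_mem' := by
    rintro x ⟨l, hl, hlx⟩
    exact ⟨l⁻¹, by filter_upwards [hl] with a h1 using inv_mem h1, hlx.inv⟩

/-- The complex span of the elements of `Δ` at distance less than `ε` from the identity. -/
def Subgroup.smallSpan (Δ : Subgroup SL(3, ℂ)) (ε : ℝ) : Submodule ℂ (Matrix (Fin 3) (Fin 3) ℂ) :=
  Submodule.span ℂ {m | ∃ γ ∈ Δ, ‖(γ : Matrix (Fin 3) (Fin 3) ℂ) - 1‖ < ε ∧ (γ : Matrix _ _ ℂ) = m}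

theorem Subgroup.smallSpan_mono (Δ : Subgroup SL(3, ℂ)) {ε δ : ℝ} (h : ε ≤ δ) :
    Δ.smallSpan ε ≤ Δ.smallSpan δ :=
  Submodule.span_mono fun _ ⟨γ, hγ, hlt, hm⟩ => ⟨γ, hγ, hlt.trans_le h, hm⟩

/-- A decreasing family of subspaces of a finite-dimensional space stabilizes. -/
theorem Subgroup.exists_smallSpan_le (Δ : Subgroup SL(3, ℂ)) {δ : ℝ} (hδ : 0 < δ) :
    ∃ ε > 0, ε ≤ δ ∧ ∀ η > 0, Δ.smallSpan ε ≤ Δ.smallSpan η := by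
  let f : ℕ →o (Submodule ℂ (Matrix (Fin 3) (Fin 3) ℂ))ᵒᵈ :=
    ⟨fun n => OrderDual.toDual (Δ.smallSpan (1 / (n + 1))), fun m n h =>
      Δ.smallSpan_mono (Nat.one_div_le_one_div h)⟩
  obtain ⟨n, hn⟩ := IsArtinian.monotone_stabilizes f
  have key (η : ℝ) (hη : 0 < η) : Δ.smallSpan (1 / (n + 1)) ≤ Δ.smallSpan η := by
    obtain ⟨m, hm⟩ := exists_nat_one_div_lt hη
    have : Δ.smallSpan (1 / (n + 1)) = Δ.smallSpan (1 / ((max n m : ℕ) + 1)) :=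
      hn (max n m) (le_max_left _ _)
    rw [this]
    exact Δ.smallSpan_mono ((Nat.one_div_le_one_div (le_max_right n m)).trans hm.le)
  refine ⟨min δ (1 / (n + 1)), lt_min hδ Nat.one_div_pos_of_nat, min_le_left _ _, fun η hη => ?_⟩
  exact (Δ.smallSpan_mono (min_le_right _ _)).trans (key η hη)

/-- Conjugation by `g` enlarges `γ - 1` by a bounded factor, and the stable span is already spanned
by elements closer to 1 by that factor. -/
theorem Subgroup.conj_mem_smallSpan {Δ : Subgroup SL(3, ℂ)} {ε : ℝ} (hε : 0 < ε)
    (h : ∀ η > 0, Δ.smallSpan ε ≤ Δ.smallSpan η) {g : SL(3, ℂ)} (hg : g ∈ Δ)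
    {a : Matrix (Fin 3) (Fin 3) ℂ} (ha : a ∈ Δ.smallSpan ε) :
    (g : Matrix (Fin 3) (Fin 3) ℂ) * a * (g⁻¹ : SL(3, ℂ)) ∈ Δ.smallSpan ε := by
  set C := ‖(g : Matrix (Fin 3) (Fin 3) ℂ)‖ * ‖((g⁻¹ : SL(3, ℂ)) : Matrix (Fin 3) (Fin 3) ℂ)‖ + 1
    with hC
  have hC0 : 0 < C := by positivity
  have hone : (g : Matrix (Fin 3) (Fin 3) ℂ) * ((g⁻¹ : SL(3, ℂ)) : Matrix (Fin 3) (Fin 3) ℂ) = 1 := by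
    rw [← Matrix.SpecialLinearGroup.coe_mul, mul_inv_cancel, Matrix.SpecialLinearGroup.coe_one]
  replace ha := h (ε / C) (by positivity) ha
  induction ha using Submodule.span_induction with
  | zero => simp
  | add x y _ _ hx hy =>
    rw [mul_add, add_mul]
    exact add_mem hx hy
  | smul c x _ hx =>
    rw [mul_smul_comm, smul_mul_assoc]
    exact Submodule.smul_mem _ c hx
  | mem x hx =>
    obtain ⟨γ, hγ, hlt, rfl⟩ := hx
    refine Submodule.subset_span ⟨g * γ * g⁻¹, mul_mem (mul_mem hg hγ) (inv_mem hg), ?_, by simp⟩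
    have hsub : ((g * γ * g⁻¹ : SL(3, ℂ)) : Matrix (Fin 3) (Fin 3) ℂ) - 1 =
        g * (γ - 1) * (g⁻¹ : SL(3, ℂ)) := by
      rw [mul_sub, sub_mul, mul_one, hone, Matrix.SpecialLinearGroup.coe_mul,
        Matrix.SpecialLinearGroup.coe_mul]
    rw [hsub, ← div_mul_cancel₀ ε hC0.ne']
    refine lt_of_le_of_lt ((norm_mul_le _ _).trans
      (mul_le_mul_of_nonneg_right (norm_mul_le _ _) (norm_nonneg _))) ?_
    have h0 := norm_nonneg ((γ : Matrix (Fin 3) (Fin 3) ℂ) - 1)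
    calc _ = ‖(γ : Matrix (Fin 3) (Fin 3) ℂ) - 1‖ * (C - 1) := by rw [hC]; ring
      _ ≤ ‖(γ : Matrix (Fin 3) (Fin 3) ℂ) - 1‖ * C := by gcongr; linarith
      _ < _ := by gcongr

namespace Horospherical

theorem span_real_eq_top (b : Frame) : Submodule.span ℝ (Set.range b.1) = ⊤ :=
  b.2.span_eq_top_of_card_eq_finrank' (by simp [finrank_C2])

/-- Conjugations by `1 + n` and `1 - n` differ by exactly twice the bracket with `n`; linearity
passes from the basis to all of `ℂ²`. -/
theorem commutator_mem_of_frame (f : C2 →ₗ[ℂ] Matrix (Fin 3) (Fin 3) ℂ) (b : Frame)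
    {A : Submodule ℂ (Matrix (Fin 3) (Fin 3) ℂ)}
    (h : ∀ i, ∀ a ∈ A, (1 + f (b.1 i)) * a * (1 - f (b.1 i)) ∈ A ∧
      (1 - f (b.1 i)) * a * (1 + f (b.1 i)) ∈ A) (x : C2) :
    ∀ a ∈ A, f x * a - a * f x ∈ A := by
  have hx : x ∈ Submodule.span ℝ (Set.range b.1) := span_real_eq_top b ▸ trivial
  induction hx using Submodule.span_induction with
  | zero => simp
  | add x y _ _ hx hy =>
    intro a ha
    have : f (x + y) * a - a * f (x + y) = (f x * a - a * f x) + (f y * a - a * f y) := by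
      rw [map_add]; noncomm_ring
    rw [this]
    exact add_mem (hx a ha) (hy a ha)
  | smul c x _ hx =>
    intro a ha
    have : f (c • x) * a - a * f (c • x) = (c : ℂ) • (f x * a - a * f x) := by
      rw [← Complex.coe_smul, map_smul, smul_sub, smul_mul_assoc, mul_smul_comm]
    rw [this]
    exact A.smul_mem _ (hx a ha)
  | mem x hx =>
    obtain ⟨i, rfl⟩ := hx
    intro a ha
    obtain ⟨h1, h2⟩ := h i a ha
    have : (2 : ℂ) • (f (b.1 i) * a - a * f (b.1 i)) =
        (1 + f (b.1 i)) * a * (1 - f (b.1 i)) - (1 - f (b.1 i)) * a * (1 + f (b.1 i)) := by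
      rw [two_smul]; noncomm_ring
    exact (A.smul_mem_iff (by norm_num : (2 : ℂ) ≠ 0)).1 (this ▸ sub_mem h1 h2)

theorem smallSpan_eq_top (τ : PairType) {Δ : Subgroup SL(3, ℂ)} (b c : Frame)
    (hb : ∀ i, uPlus τ (.ofAdd (b.1 i)) ∈ Δ) (hc : ∀ i, uMinus τ (.ofAdd (c.1 i)) ∈ Δ)
    {ε : ℝ} (hε : 0 < ε) (hε' : ε ≤ 1 / 16) (h : ∀ η > 0, Δ.smallSpan ε ≤ Δ.smallSpan η)
    (hne : ∃ γ ∈ Δ, ‖(γ : Matrix (Fin 3) (Fin 3) ℂ) - 1‖ < ε ∧ γ ≠ 1) :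
    Δ.smallSpan ε = ⊤ := by
  refine eq_top_of_commutator_mem τ
    (commutator_mem_of_frame (plusLin τ) b fun i a ha => ?_)
    (commutator_mem_of_frame (minusLin τ) c fun i a ha => ?_)
    (Submodule.subset_span ⟨1, one_mem _, by simpa using hε, by simp⟩) ?_
  · have h1 := Subgroup.conj_mem_smallSpan hε h (hb i) ha
    have h2 := Subgroup.conj_mem_smallSpan hε h (inv_mem (hb i)) ha
    rw [inv_inv, ← map_inv, ← ofAdd_neg, coe_uPlus, coe_uPlus, map_neg, ← sub_eq_add_neg] at h2
    rw [← map_inv, ← ofAdd_neg, coe_uPlus, coe_uPlus, map_neg, ← sub_eq_add_neg] at h1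
    exact ⟨h1, h2⟩
  · have h1 := Subgroup.conj_mem_smallSpan hε h (hc i) ha
    have h2 := Subgroup.conj_mem_smallSpan hε h (inv_mem (hc i)) ha
    rw [inv_inv, ← map_inv, ← ofAdd_neg, coe_uMinus, coe_uMinus, map_neg, ← sub_eq_add_neg] at h2
    rw [← map_inv, ← ofAdd_neg, coe_uMinus, coe_uMinus, map_neg, ← sub_eq_add_neg] at h1
    exact ⟨h1, h2⟩
  · obtain ⟨γ, hγ, hlt, hγ1⟩ := hne
    refine ⟨γ, Submodule.subset_span ⟨γ, hγ, hlt, rfl⟩, fun s hs => hγ1 ?_⟩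
    refine Matrix.SpecialLinearGroup.eq_one_of_val_eq_smul_one hs ?_
    have : (γ : Matrix (Fin 3) (Fin 3) ℂ) - 1 = (s - 1) • 1 := by rw [hs, sub_smul, one_smul]
    rw [this, norm_smul, norm_one, mul_one] at hlt
    exact hlt.le.trans hε'

theorem discreteTopology_of_le_limits (τ : PairType) {α : Type*} {G : Filter α} [G.NeBot]
    {Γ : α → Subgroup SL(3, ℂ)} (hΓ : ∀ᶠ a in G, DiscreteTopology (Γ a))
    {Δ : Subgroup SL(3, ℂ)} (hΔ : Δ ≤ Subgroup.limits G Γ) (b c : Frame)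
    (hb : ∀ i, uPlus τ (.ofAdd (b.1 i)) ∈ Δ) (hc : ∀ i, uMinus τ (.ofAdd (c.1 i)) ∈ Δ) :
    DiscreteTopology Δ := by
  by_contra hnd
  obtain ⟨ε, hε, hε', hmin⟩ := Δ.exists_smallSpan_le (δ := 1 / 16) (by norm_num)
  have hne : ∃ γ ∈ Δ, ‖(γ : Matrix (Fin 3) (Fin 3) ℂ) - 1‖ < ε ∧ γ ≠ 1 := by
    by_contra! h
    exact hnd (Subgroup.discreteTopology_of_norm_sub_one_lt hε h)
  have htop := smallSpan_eq_top τ b c hb hc hε hε' hmin hne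
  obtain ⟨v, hv, hvmem⟩ := exists_linearIndependent_of_span_eq_top
    (Matrix.stdBasis ℂ (Fin 3) (Fin 3)) htop
  choose γ hγ hlt hγv using hvmem
  choose g hg hgγ using fun i => hΔ (hγ i)
  have hcoe (i) : Tendsto (fun a => (g i a : Matrix (Fin 3) (Fin 3) ℂ)) G (𝓝 (v i)) :=
    hγv i ▸ (continuous_subtype_val.tendsto (γ i)).comp (hgγ i)
  have hli : ∀ᶠ a in G, LinearIndependent ℂ fun i => (g i a : Matrix (Fin 3) (Fin 3) ℂ) :=
    (tendsto_pi_nhds.2 hcoe).eventually hv.eventually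
  have hsm : ∀ᶠ a in G, ∀ i, ‖(g i a : Matrix (Fin 3) (Fin 3) ℂ) - 1‖ < 1 / 16 :=
    eventually_all.2 fun i => ((hcoe i).sub_const 1).norm.eventually_lt_const
      (by rw [← hγv i]; exact (hlt i).trans_le hε')
  obtain ⟨a, hdisc, hlia, hsma, hga⟩ :=
    (hΓ.and (hli.and (hsm.and (eventually_all.2 hg)))).exists
  have hspan := hlia.span_eq_top_of_card_eq_finrank' (by simp [finrank_matrix])
  have hone := (Γ a).eq_one_of_small_of_centralizer_scalar 1 (S := Set.range fun i => g i a)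
    (by rintro _ ⟨i, rfl⟩; exact hga i)
    (by
      rintro _ ⟨i, rfl⟩
      rw [coe_conjIncl_sub_one]
      simpa using (hsma i).le)
    (by
      intro z hz
      have hall (m : Matrix (Fin 3) (Fin 3) ℂ) : Commute m z := by
        have hm : m ∈ Submodule.span ℂ (Set.range fun i => (g i a : Matrix (Fin 3) (Fin 3) ℂ)) :=
          hspan ▸ trivial
        induction hm using Submodule.span_induction with
        | zero => exact Commute.zero_left z
        | add x y _ _ hx hy => exact hx.add_left hy
        | smul s x _ hx => exact hx.smul_left s
        | mem x hx =>
          obtain ⟨i, rfl⟩ := hx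
          exact hz _ ⟨i, rfl⟩
      exact exists_eq_smul_one_of_commute τ (fun x => hall _) (y := Pi.single 0 1) (by simp)
        (hall _))
  -- All nine independent matrices are now 1; two of them already contradict independence.
  have h01 : (g (0, 0) a : Matrix (Fin 3) (Fin 3) ℂ) = g (0, 1) a := by
    exact congrArg Subtype.val ((hone _ ⟨(0, 0), rfl⟩).trans (hone _ ⟨(0, 1), rfl⟩).symm)
  simpa using hlia.injective h01

/-! ### Compactness of the lattices in the opposite subgroup -/

theorem exists_minimum_le (τ : PairType) (C : ℝ) : ∃ r > 0, ∀ (Γ : Subgroup SL(3, ℂ))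
    [DiscreteTopology Γ] (b : Frame), (∀ i, ‖b.1 i‖ ≤ C) → (∀ i, uPlus τ (.ofAdd (b.1 i)) ∈ Γ) →
      ∀ y, uMinus τ (.ofAdd y) ∈ Γ → y ≠ 0 → r ≤ ‖y‖ := by
  obtain ⟨K, hK, hKp, hKm⟩ : ∃ K : ℝ, 0 < K ∧ (∀ x, ‖plusLin τ x‖ ≤ K * ‖x‖) ∧
      ∀ x, ‖minusLin τ x‖ ≤ K * ‖x‖ := by
    obtain ⟨p, hp, hp'⟩ := (plusLin τ).exists_pos_norm_le
    obtain ⟨m, hm, hm'⟩ := (minusLin τ).exists_pos_norm_le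
    refine ⟨p + m, by positivity, fun x => (hp' x).trans ?_, fun x => (hm' x).trans ?_⟩
    · gcongr; linarith
    · gcongr; linarith
  set D := |C| + 1 with hD
  have hD0 : 0 < D := by positivity
  -- This `t` brings the basis in `U` within 1/16 of the identity. Since `U⁻` is expanded by `t⁻¹`,
  -- vectors shorter than `t / (16 * K)` also land there.
  set t : ℝ := 1 / (16 * K * D) with ht
  have ht0 : 0 < t := by positivity
  have htC : (t : ℂ) ≠ 0 := by exact_mod_cast ht0.ne'
  refine ⟨t / (16 * K), by positivity, fun Γ _ b hbC hb y hy hy0 => ?_⟩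
  by_contra! hlt
  have key := Γ.eq_one_of_small_of_centralizer_scalar (scaling τ t htC)
    (S := insert (uMinus τ (.ofAdd y)) (Set.range fun i => uPlus τ (.ofAdd (b.1 i))))
    (by
      rintro _ (rfl | ⟨i, rfl⟩)
      · exact hy
      · exact hb i)
    (by
      rintro _ (rfl | ⟨i, rfl⟩)
      · rw [coe_conjIncl_sub_one, coe_uMinus, add_sub_cancel_left, scaling_minusLin, norm_smul,
          norm_inv, Complex.norm_real, Real.norm_of_nonneg ht0.le]
        calc t⁻¹ * ‖minusLin τ y‖ ≤ t⁻¹ * (K * (t / (16 * K))) := by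
              gcongr
              exact (hKm y).trans (by gcongr)
          _ = 1 / 16 := by field_simp
      · rw [coe_conjIncl_sub_one, coe_uPlus, add_sub_cancel_left, scaling_plusLin, norm_smul,
          Complex.norm_real, Real.norm_of_nonneg ht0.le]
        calc t * ‖plusLin τ (b.1 i)‖ ≤ t * (K * D) := by
              gcongr
              refine (hKp _).trans ?_
              gcongr
              linarith [hbC i, le_abs_self C]
          _ = 1 / 16 := by rw [ht]; field_simp)
    (by
      intro z hz
      have hone {n : Matrix (Fin 3) (Fin 3) ℂ} (h : Commute (1 + n) z) : Commute n z := by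
        simpa using h.sub_left (Commute.one_left z)
      refine exists_eq_smul_one_of_commute τ (fun x => ?_) hy0
        (hone (coe_uMinus τ y ▸ hz _ (Set.mem_insert _ _)))
      have hx : x ∈ Submodule.span ℝ (Set.range b.1) := span_real_eq_top b ▸ trivial
      induction hx using Submodule.span_induction with
      | zero => rw [map_zero]; exact Commute.zero_left z
      | add x y _ _ hx hy => rw [map_add]; exact hx.add_left hy
      | smul s x _ hx =>
        rw [← Complex.coe_smul, map_smul]
        exact hx.smul_left _
      | mem x hx =>
        obtain ⟨i, rfl⟩ := hx
        exact hone (coe_uPlus τ (b.1 i) ▸ hz _ (Set.mem_insert_of_mem _ ⟨i, rfl⟩)))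
  have := key _ (Set.mem_insert _ _)
  rw [← map_one (uMinus τ)] at this
  exact hy0 (Multiplicative.ofAdd.injective (uMinus_injective τ this))


/-- The action of `H` on `U⁻` by conjugation, as a real linear automorphism. -/
noncomputable def minusEquiv (τ : PairType) (A : SL(2, ℂ)) : C2 ≃ₗ[ℝ] C2 :=
  (((minusAct τ A)⁻¹).toLin'OfInv (M' := minusAct τ A)
    (Matrix.nonsing_inv_mul _ (by simp [det_minusAct]))
    (Matrix.mul_nonsing_inv _ (by simp [det_minusAct]))).restrictScalars ℝ

theorem minusEquiv_apply (τ : PairType) (A : SL(2, ℂ)) (y : C2) :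
    minusEquiv τ A y = (minusAct τ A).mulVec y := by
  simp [minusEquiv, Matrix.toLin'OfInv]

/-- The real determinant is the norm of the complex one. Hence covolume is constant along the orbit.
-/
theorem det_minusEquiv (τ : PairType) (A : SL(2, ℂ)) :
    LinearMap.det (minusEquiv τ A : C2 →ₗ[ℝ] C2) = 1 := by
  have : (minusEquiv τ A : C2 →ₗ[ℝ] C2) =
      (Matrix.toLin' (minusAct τ A)).restrictScalars ℝ :=
    LinearMap.ext fun y => minusEquiv_apply τ A y
  rw [this, LinearMap.det_restrictScalars, LinearMap.det_toLin', det_minusAct, map_one]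

theorem conj_leviEmb_latticeOfFrame (τ : PairType) (A : SL(2, ℂ)) {b c : Frame}
    (h : Submodule.span ℤ (Set.range c.1) =
      Submodule.span ℤ (Set.range (minusEquiv τ A ∘ b.1))) :
    conj (leviEmb τ A) (latticeOfFrame (uMinus τ) b).1 = (latticeOfFrame (uMinus τ) c).1 := by
  ext g
  have hmap : Submodule.span ℤ (Set.range c.1) = (Submodule.span ℤ (Set.range b.1)).map
      ((minusEquiv τ A : C2 →ₗ[ℝ] C2).restrictScalars ℤ) := by
    rw [h, Submodule.map_span, Set.range_comp]
    rfl
  rw [mem_latticeOfFrame, hmap]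
  constructor
  · rintro ⟨k, hk, rfl⟩
    obtain ⟨x, hx, rfl⟩ := mem_latticeOfFrame.1 hk
    exact ⟨_, ⟨x, hx, minusEquiv_apply τ A x⟩, (leviEmb_mul_uMinus τ A x).symm⟩
  · rintro ⟨_, ⟨x, hx, rfl⟩, rfl⟩
    refine ⟨_, mem_latticeOfFrame.2 ⟨x, hx, rfl⟩, (leviEmb_mul_uMinus τ A x).trans ?_⟩
    rw [← minusEquiv_apply]
    rfl

theorem continuous_coe_uPlus (τ : PairType) : Continuous fun x : C2 => uPlus τ (.ofAdd x) := by
  refine continuous_induced_rng.2 ?_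
  change Continuous fun x => plusMat τ x
  refine Continuous.congr (f := fun x => 1 + plusLin τ x)
    (continuous_const.add (plusLin τ).continuous_of_finiteDimensional) fun x => ?_
  exact (coe_uPlus τ x).symm

theorem continuous_coe_uMinus (τ : PairType) : Continuous fun x : C2 => uMinus τ (.ofAdd x) := by
  refine continuous_induced_rng.2 ?_
  change Continuous fun x => minusMat τ x
  refine Continuous.congr (f := fun x => 1 + minusLin τ x)
    (continuous_const.add (minusLin τ).continuous_of_finiteDimensional) fun x => ?_
  exact (coe_uMinus τ x).symm

theorem discreteTopology_conj {Γ : Subgroup SL(3, ℂ)} (h : SL(3, ℂ)) [DiscreteTopology Γ] :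
    DiscreteTopology (conj h Γ) := by
  let f : conj h Γ → Γ := fun g => ⟨h⁻¹ * g * h, by
    obtain ⟨g, k, hk, rfl⟩ := g
    simpa [mul_assoc] using hk⟩
  refine DiscreteTopology.of_continuous_injective (f := f) ?_ ?_
  · exact Continuous.subtype_mk ((continuous_const.mul continuous_subtype_val).mul
      continuous_const) _
  · intro g k hgk
    have : h⁻¹ * (g : SL(3, ℂ)) * h = h⁻¹ * k * h := congrArg Subtype.val hgk
    exact Subtype.ext (by simpa using this)

theorem latticeOfFrame_le_limits {u : Multiplicative C2 →* SL(3, ℂ)}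
    (hu : Continuous fun x : C2 => u (.ofAdd x)) {α : Type*} {G : Filter α}
    {Γ : α → Subgroup SL(3, ℂ)} {b : Frame} {a : α → Fin 4 → C2} (ha : Tendsto a G (𝓝 b.1))
    (h : ∀ᶠ n in G, ∀ i, u (.ofAdd (a n i)) ∈ Γ n) :
    (latticeOfFrame u b).1 ≤ Subgroup.limits G Γ := by
  intro g hg
  obtain ⟨x, hx, rfl⟩ := mem_latticeOfFrame.1 hg
  induction hx using Submodule.span_induction with
  | zero =>
    rw [ofAdd_zero, map_one]
    exact one_mem _
  | add x y hx' hy' hx hy =>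
    rw [ofAdd_add, map_mul]
    exact mul_mem (hx (mem_latticeOfFrame.2 ⟨x, hx', rfl⟩))
      (hy (mem_latticeOfFrame.2 ⟨y, hy', rfl⟩))
  | smul n x hx' hx =>
    rw [ofAdd_zsmul, map_zpow]
    exact zpow_mem (hx (mem_latticeOfFrame.2 ⟨x, hx', rfl⟩)) n
  | mem x hx =>
    obtain ⟨i, rfl⟩ := hx
    exact ⟨fun n => u (.ofAdd (a n i)), h.mono fun n hn => hn i,
      (hu.tendsto _).comp (tendsto_pi_nhds.1 ha i)⟩

theorem basis_mem_latticeOfFrame {u : Multiplicative C2 →* SL(3, ℂ)} (b : Frame) (i : Fin 4) :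
    u (.ofAdd (b.1 i)) ∈ (latticeOfFrame u b).1 :=
  mem_latticeOfFrame.2 ⟨_, Submodule.subset_span ⟨i, rfl⟩, rfl⟩

end Horospherical

/-! ### Passage to the limit -/

theorem mainTheorem4 (τ : Horospherical.PairType)
    (F₁ : Horospherical.LatticeSpace (Horospherical.uPlus τ))
    (F₂ : Horospherical.LatticeSpace (Horospherical.uMinus τ))
    (hF : DiscreteTopology ↥(F₁.1 ⊔ F₂.1))
    (E₁ : Horospherical.LatticeSpace (Horospherical.uPlus τ))
    (hE₁ : E₁ ∈ closure (Horospherical.orbit (Horospherical.H τ) F₁)) :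
    ∃ E₂ : Horospherical.LatticeSpace (Horospherical.uMinus τ),
      (E₁, E₂) ∈ closure (Horospherical.orbitPair (Horospherical.H τ) F₁ F₂) ∧
        DiscreteTopology ↥(E₁.1 ⊔ E₂.1) := by
  open Horospherical in
  obtain ⟨b, rfl⟩ := latticeOfFrame_surjective _ E₁
  obtain ⟨c₀, rfl⟩ := latticeOfFrame_surjective _ F₂
  -- The ultrafilter lives on the frames themselves, so the index `a` is a basis of the moving
  -- lattice in `U`, and further limits need no subsequences.
  obtain ⟨G, hGmem, hGb⟩ := mem_closure_iff_ultrafilter.1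
    (mem_closure_preimage_latticeOfFrame (uPlus_injective τ) hE₁)
  have hA : ∀ᶠ a in G, ∃ A : SL(2, ℂ), (latticeOfFrame (uPlus τ) a).1 = conj (leviEmb τ A) F₁.1 := by
    filter_upwards [hGmem] with a ha
    obtain ⟨_, ⟨A, rfl⟩, hA⟩ := ha
    exact ⟨A, hA⟩
  obtain ⟨A, hA⟩ := hA.choice
  let Γ : Frame → Subgroup SL(3, ℂ) := fun a =>
    conj (leviEmb τ (A a)) (F₁.1 ⊔ (latticeOfFrame (uMinus τ) c₀).1)
  have hΓdisc (a) : DiscreteTopology (Γ a) := discreteTopology_conj _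
  have hGt : Tendsto (fun a : Frame => a.1) G (𝓝 b.1) :=
    (continuous_subtype_val.tendsto b).comp hGb
  have hplus : ∀ᶠ a in G, ∀ i, uPlus τ (.ofAdd (a.1 i)) ∈ Γ a := by
    filter_upwards [hA] with a ha i
    exact Subgroup.map_mono le_sup_left (ha.le (basis_mem_latticeOfFrame a i))
  let B₀ : Basis (Fin 4) ℝ C2 :=
    basisOfLinearIndependentOfCardEqFinrank' c₀.1 c₀.2 (by simp [finrank_C2])
  have hB₀ : ⇑B₀ = c₀.1 := coe_basisOfLinearIndependentOfCardEqFinrank' _ _ _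
  let B : Frame → Basis (Fin 4) ℝ C2 := fun a => B₀.map (minusEquiv τ (A a))
  have hB (a) : ⇑(B a) = minusEquiv τ (A a) ∘ c₀.1 := by
    ext1 i; simp [B, hB₀]
  have hdet (a) : |B₀.det (B a)| = 1 := by
    have : ⇑(B a) = (minusEquiv τ (A a) : C2 →ₗ[ℝ] C2) ∘ B₀ := by rw [hB, hB₀]; rfl
    rw [this, Basis.det_comp, det_minusEquiv, B₀.det_self, mul_one, abs_one]
  have hconj (a) {c : Frame} (hc : Submodule.span ℤ (Set.range c.1) =
      Submodule.span ℤ (Set.range (B a))) := conj_leviEmb_latticeOfFrame τ (A a) (b := c₀)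
        (hc.trans (by rw [hB]))
  obtain ⟨r, hr, hmin⟩ := exists_minimum_le τ (‖b.1‖ + 1)
  have hminB : ∀ᶠ a in G, ∀ x ∈ Submodule.span ℤ (Set.range (B a)), x ≠ 0 → r ≤ ‖x‖ := by
    filter_upwards [hplus, hGt.norm.eventually_lt_const (lt_add_one ‖b.1‖)] with a ha hn x hx hx0
    refine hmin (Γ a) a (fun i => (norm_le_pi_norm a.1 i).trans hn.le) ha x ?_ hx0
    refine Subgroup.map_mono le_sup_right ?_
    exact (hconj a (c := ⟨B a, (B a).linearIndependent⟩) rfl).ge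
      (mem_latticeOfFrame.2 ⟨x, hx, rfl⟩)
  obtain ⟨c, c', hcc', hc'li, hc⟩ := exists_tendsto_basis_of_minimum_le B₀ G B hdet hr hminB
  have hminus : ∀ᶠ a in G, ∀ i, uMinus τ (.ofAdd (c a i)) ∈ Γ a := by
    filter_upwards [hc] with a ha i
    exact Subgroup.map_mono le_sup_right ((hconj a (c := ⟨c a, ha.1⟩) ha.2).ge
      (basis_mem_latticeOfFrame ⟨c a, ha.1⟩ i))
  refine ⟨latticeOfFrame (uMinus τ) ⟨c', hc'li⟩, ?_, ?_⟩
  · have hfr : ∀ᶠ a in G, ∃ d : Frame, d.1 = c a := hc.mono fun a ha => ⟨⟨c a, ha.1⟩, rfl⟩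
    have : Nonempty Frame := ⟨b⟩
    -- The vectors `c a` form a frame only eventually, so `d` replaces them by genuine frames.
    obtain ⟨d, hd⟩ := hfr.choice
    have hdt : Tendsto d G (𝓝 ⟨c', hc'li⟩) :=
      tendsto_subtype_rng.2 (hcc'.congr' (hd.mono fun a ha => ha.symm))
    refine mem_closure_of_tendsto
      (((continuous_latticeOfFrame (uPlus τ)).tendsto b).comp hGb |>.prodMk_nhds
        (((continuous_latticeOfFrame (uMinus τ)).tendsto _).comp hdt)) ?_
    filter_upwards [hA, hc, hd] with a h1 h2 h3
    exact ⟨_, ⟨A a, rfl⟩, h1, (hconj a (by rw [h3]; exact h2.2)).symm⟩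
  · refine discreteTopology_of_le_limits τ (G := (G : Filter Frame)) (.of_forall hΓdisc)
      (sup_le (latticeOfFrame_le_limits (continuous_coe_uPlus τ) hGt hplus)
        (latticeOfFrame_le_limits (continuous_coe_uMinus τ) (b := ⟨c', hc'li⟩) hcc' hminus))
      b ⟨c', hc'li⟩ (fun i => Subgroup.mem_sup_left (basis_mem_latticeOfFrame b i))
      (fun i => Subgroup.mem_sup_right (basis_mem_latticeOfFrame ⟨c', hc'li⟩ i))
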